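/- **Conventions.** Let $\mathbb U$ be the standard universe (a model of ZFC containing all the standard objects below, concretely the ZFC sets over a fixed type universe) and let ${}^*\mathbb U$ be a $|\mathbb U|^+$-saturated elementary extension of $\mathbb U$ in the language of set theory, with embedding $X\mapsto{}^*X$. A *uniform pair* $(X,A)$ is a uniform space $X$ with a subset $A\subseteq X$; it is *precompact* if $X$ is totally bounded. For $x,y\in{}^*X$ write $x\approx y$ if $(x,y)\in{}^*U$ for every entourage $U$ of $X$. An *S-continuous map* $f:{}^*(X,A)\to{}^*(Y,B)$ is an internal map $f:{}^*X\to{}^*Y$ with $f({}^*A)\subseteq{}^*B$ such that $x\approx x'$ implies $f(x)\approx f(x')$ for all $x,x'\in{}^*X$. Let $\mathbf{pUPair}$ be the category of precompact uniform pairs and uniformly continuous maps of pairs, and $\mathbf{pUPair}_S$ the category with the same objects and with S-continuous maps as morphisms; $f\mapsto{}^*f$ embeds $\mathbf{pUPair}$ into $\mathbf{pUPair}_S$. S-continuous maps $f,g:{}^*(X,A)\to{}^*(Y,B)$ are *$S_\bullet$-homotopic* if for some hyperreal $T\ge 0$ (possibly infinite) there is an internal map $h:{}^*X\times{}^*[0,T]\to{}^*Y$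 with $h({}^*A\times{}^*[0,T])\subseteq{}^*B$ such that $x\approx x'$ and $t\approx t'$ imply $h(x,t)\approx h(x',t')$, and such that $h(\cdot,0)=f$ and $h(\cdot,T)=g$; here ${}^*[0,T]=\{t\in{}^*\mathbb R: 0\le t\le T\}$. For an entourage $V$ of $Y$ let $V[y]=\{z:(y,z)\in V\}$. A *uniform cover* of $X$ is a family $\mathcal U$ of subsets such that, for some entourage $U$, every $U[x]$ $(x\in X)$ is contained in a member of $\mathcal U$. Let $X_{\mathcal U}$ (resp. $A_{\mathcal U}$) be the simplicial set whose $p$-simplices are the tuples $(a_0,\dots,a_p)$ of points of $X$ (resp. of $A$) that lie in a common member of $\mathcal U$. For an abelian group $G$, the *uniform Vietoris homology* is the inverse limit, over the uniform covers of $X$ directed by refinement, $$\check H^u_n(X,A;G)=\varprojlim_{\mathcal U}H_n(X_{\mathcal U},A_{\mathcal U};G),$$ with projections $\pi_{\mathcal U}$. It is a functor on uniform pairs: $\pi_{\mathcal V}\circ\check H^u_n(f;G)=H_n(f;G)\circ\pi_{f^{-1}\mathcal V}$. Let $f:{}^*(X,A)\to{}^*(Y,B)$ be S-continuous and $W$ an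 entourage of $Y$. A *$W$-preshadow* of $f$ is a map $k:X\to Y$ with $k(A)\subseteq B$ such that there is an entourage $U$ of $X$ with $(k(x),k(y))\in W$ whenever $(x,y)\in U$, and such that $({}^*k(x),f(x))\in{}^*W$ for all $x\in{}^*X$. A homomorphism $\varphi:\check H^u_n(X,A;G)\to\check H^u_n(Y,B;G)$ is *induced by $f$* if $\pi_{\mathcal V}\circ\varphi=H_n(k;G)\circ\pi_{\mathcal U}$ whenever $\mathcal V$ is a uniform cover of $Y$, $V$ is an entourage of $Y$ such that every $V[y]$ is contained in a member of $\mathcal V$, $W$ is an entourage with $W^2\subseteq V$, $k$ is a $W$-preshadow of $f$, and $\mathcal U$ is a uniform cover of $X$ for which $k$ is a simplicial map $(X_{\mathcal U},A_{\mathcal U})\to(Y_{\mathcal V},B_{\mathcal V})$. **Theorem.** Let $G$ be an abelian group and $n\ge 0$. Every S-continuous map $f:{}^*(X,A)\to{}^*(Y,B)$ between precompact uniform pairs induces exactly one homomorphism $\check H^u_n(f;G):\check H^u_n(X,A;G)\to\check H^u_n(Y,B;G)$. These homomorphisms make $\check H^u_n(\cdot;G)$ a functor on $\mathbf{pUPair}_S$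 which extends the uniform Vietoris homology functor on $\mathbf{pUPair}$ along the embedding $f\mapsto{}^*f$. Moreover, if two S-continuous maps $f,g:{}^*(X,A)\to{}^*(Y,B)$ between precompact uniform pairs are $S_\bullet$-homotopic, then $\check H^u_n(f;G)=\check H^u_n(g;G)$. -/

import Mathlib

open CategoryTheory CategoryTheory.Limits Opposite
open scoped FirstOrder Simplicial Uniformity

universe u v w

noncomputable section

/-! ## Simplicial pairs and their homology -/

/-- The Vietoris complex `V(α, β, R)`: the simplicial set whose `p`-simplices are the tuples
`(a₀, …, a_p)` of elements of `α` such that some `b : β` satisfies `aᵢ R b` for all `i`. -/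
def vietorisComplex {α : Type u} {β : Type w} (R : α → β → Prop) : SSet.{u} where
  obj Δ := {a : Fin (Δ.unop.len + 1) → α // ∃ b, ∀ i, R (a i) b}
  map θ := ↾fun a => ⟨fun i => a.1 (θ.unop.toOrderHom i), a.2.imp fun _ hb _ => hb _⟩

/-- A map of vertices which carries tuples with a common `R`-bound to tuples with a common
`S`-bound is a simplicial map of Vietoris complexes. -/
def vietorisComplexMap {α β : Type u} {γ δ : Type w} {R : α → γ → Prop} {S : β → δ → Prop}
    (k : α → β)
    (hk : ∀ (p : ℕ) (a : Fin (p + 1) → α), (∃ c, ∀ i, R (a i) c) → ∃ d, ∀ i, S (k (a i)) d) :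
    vietorisComplex R ⟶ vietorisComplex S where
  app Δ := ↾fun a => ⟨fun i => k (a.1 i), hk _ a.1 a.2⟩

/-- The relative homology functor of simplicial pairs `K ⟶ L` in degree `n` with coefficients
in `G`: the homology of the cokernel of the map of simplicial chain complexes. -/
def relativeHomology (G : Type u) [AddCommGroup G] (n : ℕ) :
    Arrow SSet.{u} ⥤ AddCommGrpCat.{u} :=
  ((SSet.chainComplexFunctor AddCommGrpCat.{u}).obj (AddCommGrpCat.of G)).mapArrow ⋙
    coker (ChainComplex AddCommGrpCat.{u} ℕ) ⋙ HomologicalComplex.homologyFunctor _ _ n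

/-! ## Uniform pairs and uniform Vietoris homology -/

/-- A uniform pair `(X, A)`: a uniform space with a subset. -/
structure UPair : Type (u + 1) where
  carrier : Type u
  [uniformSpace : UniformSpace carrier]
  sub : Set carrier

attribute [instance] UPair.uniformSpace

/-- Morphisms of uniform pairs: uniformly continuous maps respecting the subsets. -/
@[ext]
structure UPair.Hom (P Q : UPair.{u}) : Type u where
  toFun : P.carrier → Q.carrier
  uniformContinuous : UniformContinuous toFun
  mapsTo : Set.MapsTo toFun P.sub Q.sub

instance : Category UPair.{u} where
  Hom := UPair.Hom
  id P := ⟨id, uniformContinuous_id, Set.mapsTo_id _⟩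
  comp f g := ⟨g.toFun ∘ f.toFun, g.uniformContinuous.comp f.uniformContinuous,
    g.mapsTo.comp f.mapsTo⟩

/-- A uniform pair `(X, A)` is precompact if `X` is totally bounded. -/
def IsPrecompactPair : ObjectProperty UPair.{u} :=
  fun P => TotallyBounded (Set.univ : Set P.carrier)

/-- The category of precompact uniform pairs and uniformly continuous maps. -/
abbrev PUPair : Type (u + 1) := IsPrecompactPair.{u}.FullSubcategory

/-- `𝒱` refines `𝒰`: every member of `𝒱` is contained in a member of `𝒰`. -/
def Refines {X : Type u} (𝒱 𝒰 : Set (Set X)) : Prop :=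
  ∀ S ∈ 𝒱, ∃ T ∈ 𝒰, S ⊆ T

/-- The family `{V[x] | x ∈ X}`, where `V[x] = {y | (x, y) ∈ V}`. -/
def ballCover {X : Type u} (V : Set (X × X)) : Set (Set X) :=
  Set.range fun x => {y | (x, y) ∈ V}

/-- Uniform covers: the families of subsets that are refined by `{U[x] | x ∈ X}` for some
entourage `U`. -/
def UCov (X : Type u) [UniformSpace X] : Type u :=
  {𝒰 : Set (Set X) // ∃ U ∈ 𝓤 X, Refines (ballCover U) 𝒰}

/-- Uniform covers are ordered by refinement, finer covers being larger. -/
instance (X : Type u) [UniformSpace X] : Preorder (UCov X) where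
  le 𝒰 𝒱 := Refines 𝒱.1 𝒰.1
  le_refl _ S hS := ⟨S, hS, subset_rfl⟩
  le_trans _ _ _ h₁ h₂ S hS := by
    obtain ⟨T, hT, hST⟩ := h₂ S hS
    obtain ⟨R, hR, hTR⟩ := h₁ T hT
    exact ⟨R, hR, hST.trans hTR⟩

/-- A map `k : X → Y` with `k(A) ⊆ B` is a simplicial map `(X_𝒰, A_𝒰) → (Y_𝒱, B_𝒱)`: it carries
every finite nonempty tuple of points lying in a member of `𝒰` to a tuple of points lying in a
member of `𝒱`. -/
structure IsSimplicialPairMap (P Q : UPair.{u}) (𝒰 : Set (Set P.carrier))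
    (𝒱 : Set (Set Q.carrier)) (k : P.carrier → Q.carrier) : Prop where
  mapsTo : Set.MapsTo k P.sub Q.sub
  map_simplex : ∀ (p : ℕ) (a : Fin (p + 1) → P.carrier),
    (∃ S ∈ 𝒰, ∀ i, a i ∈ S) → ∃ T ∈ 𝒱, ∀ i, k (a i) ∈ T

/-- The simplicial pair `(X_𝒰, A_𝒰)`, `X_𝒰 = V(X, 𝒰, ∈)`, `A_𝒰 = V(A, 𝒰, ∈)`, as the
inclusion `A_𝒰 ⟶ X_𝒰`. -/
def vietorisPair (P : UPair.{u}) (𝒰 : Set (Set P.carrier)) : Arrow SSet.{u} :=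
  Arrow.mk (vietorisComplexMap (R := fun (a : P.sub) (S : 𝒰) => a.1 ∈ S.1)
    (S := fun (x : P.carrier) (S : 𝒰) => x ∈ S.1) Subtype.val fun _ _ h => h)

/-- The map of simplicial pairs `(X_𝒰, A_𝒰) ⟶ (Y_𝒱, B_𝒱)` induced by a map `k : X → Y`. -/
def vietorisPairMap {P Q : UPair.{u}} {𝒰 : Set (Set P.carrier)} {𝒱 : Set (Set Q.carrier)}
    (k : P.carrier → Q.carrier) (hk : IsSimplicialPairMap P Q 𝒰 𝒱 k) :
    vietorisPair P 𝒰 ⟶ vietorisPair Q 𝒱 :=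
  Arrow.homMk (f := vietorisPair P 𝒰) (g := vietorisPair Q 𝒱)
    (vietorisComplexMap (R := fun (a : P.sub) (S : 𝒰) => a.1 ∈ S.1)
      (S := fun (b : Q.sub) (T : 𝒱) => b.1 ∈ T.1)
      (fun a : P.sub => (⟨k a.1, hk.mapsTo a.2⟩ : Q.sub)) fun p a h => by
      obtain ⟨S, hS⟩ := h
      obtain ⟨T, hT, h'⟩ := hk.map_simplex p (fun i => (a i).1) ⟨S.1, S.2, hS⟩
      exact ⟨⟨T, hT⟩, h'⟩)
    (vietorisComplexMap (R := fun (x : P.carrier) (S : 𝒰) => x ∈ S.1)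
      (S := fun (y : Q.carrier) (T : 𝒱) => y ∈ T.1) k fun p a h => by
      obtain ⟨S, hS⟩ := h
      obtain ⟨T, hT, h'⟩ := hk.map_simplex p a ⟨S.1, S.2, hS⟩
      exact ⟨⟨T, hT⟩, h'⟩)
    rfl

theorem isSimplicialPairMap_id (P : UPair.{u}) {𝒰 𝒱 : Set (Set P.carrier)}
    (h : Refines 𝒱 𝒰) : IsSimplicialPairMap P P 𝒱 𝒰 id where
  mapsTo := Set.mapsTo_id _
  map_simplex _ _ := fun ⟨S, hS, ha⟩ => (h S hS).imp fun _ hT => ⟨hT.1, fun i => hT.2 (ha i)⟩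

theorem IsSimplicialPairMap.comp {P Q R : UPair.{u}} {𝒰 : Set (Set P.carrier)}
    {𝒱 : Set (Set Q.carrier)} {𝒲 : Set (Set R.carrier)} {k : P.carrier → Q.carrier}
    {l : Q.carrier → R.carrier} (hl : IsSimplicialPairMap Q R 𝒱 𝒲 l)
    (hk : IsSimplicialPairMap P Q 𝒰 𝒱 k) : IsSimplicialPairMap P R 𝒰 𝒲 (l ∘ k) where
  mapsTo := hl.mapsTo.comp hk.mapsTo
  map_simplex p a h := hl.map_simplex p _ (hk.map_simplex p a h)

theorem vietorisPairMap_comp {P Q R : UPair.{u}} {𝒰 : Set (Set P.carrier)}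
    {𝒱 : Set (Set Q.carrier)} {𝒲 : Set (Set R.carrier)} {k : P.carrier → Q.carrier}
    {l : Q.carrier → R.carrier} (hl : IsSimplicialPairMap Q R 𝒱 𝒲 l)
    (hk : IsSimplicialPairMap P Q 𝒰 𝒱 k) :
    vietorisPairMap k hk ≫ vietorisPairMap l hl = vietorisPairMap (l ∘ k) (hl.comp hk) :=
  rfl

/-- The inverse system of simplicial pairs `𝒰 ↦ (X_𝒰, A_𝒰)`. -/
def vietorisPairSystem (P : UPair.{u}) : (UCov P.carrier)ᵒᵖ ⥤ Arrow SSet.{u} where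
  obj 𝒰 := vietorisPair P 𝒰.unop.1
  map h := vietorisPairMap id (isSimplicialPairMap_id P h.unop.le)
  map_id _ := rfl
  map_comp _ _ := rfl

/-- The inverse system `𝒰 ↦ H_n(X_𝒰, A_𝒰; G)` over the directed set of uniform covers. -/
def vietorisSystem (G : Type u) [AddCommGroup G] (n : ℕ) (P : UPair.{u}) :
    (UCov P.carrier)ᵒᵖ ⥤ AddCommGrpCat.{u} :=
  vietorisPairSystem P ⋙ relativeHomology G n

/-- The uniform Vietoris homology group `Ȟᵘ_n(X, A; G)`, the inverse limit of the groups
`H_n(X_𝒰, A_𝒰; G)` over the uniform covers `𝒰` of `X`. -/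
def uvHomology (G : Type u) [AddCommGroup G] (n : ℕ) (P : UPair.{u}) : AddCommGrpCat.{u} :=
  limit (vietorisSystem G n P)

/-- The projection `Ȟᵘ_n(X, A; G) ⟶ H_n(X_𝒰, A_𝒰; G)`. -/
def uvProj (G : Type u) [AddCommGroup G] (n : ℕ) (P : UPair.{u}) (𝒰 : UCov P.carrier) :
    uvHomology G n P ⟶ (relativeHomology G n).obj (vietorisPair P 𝒰.1) :=
  limit.π (vietorisSystem G n P) (op 𝒰)

/-- The preimage `f⁻¹𝒱` of a uniform cover under a uniformly continuous map. -/
def UCov.preimage {P Q : UPair.{u}} (f : P ⟶ Q) (𝒱 : UCov Q.carrier) : UCov P.carrier :=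
  ⟨Set.preimage f.toFun '' 𝒱.1, by
    obtain ⟨V, hV, h⟩ := 𝒱.2
    refine ⟨_, f.uniformContinuous hV, ?_⟩
    rintro _ ⟨x, rfl⟩
    obtain ⟨T, hT, hxT⟩ := h _ ⟨f.toFun x, rfl⟩
    exact ⟨_, ⟨T, hT, rfl⟩, fun y hy => hxT hy⟩⟩

theorem isSimplicialPairMap_preimage {P Q : UPair.{u}} (f : P ⟶ Q) (𝒱 : UCov Q.carrier) :
    IsSimplicialPairMap P Q (𝒱.preimage f).1 𝒱.1 f.toFun where
  mapsTo := f.mapsTo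
  map_simplex := by
    rintro p a ⟨_, ⟨T, hT, rfl⟩, ha⟩
    exact ⟨T, hT, ha⟩

/-- If `k` is simplicial for `𝒰` and `𝒱`, and `𝒲` refines `𝒰`, then the homomorphisms
`H_n(k) ∘ π_𝒰` and `H_n(k) ∘ π_𝒲` agree. -/
theorem uvProj_comp_map (G : Type u) [AddCommGroup G] (n : ℕ) {P Q : UPair.{u}}
    {𝒰 𝒲 : UCov P.carrier} (hle : 𝒰 ≤ 𝒲) {𝒱 : Set (Set Q.carrier)}
    {k : P.carrier → Q.carrier} (hk : IsSimplicialPairMap P Q 𝒰.1 𝒱 k)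
    (hk' : IsSimplicialPairMap P Q 𝒲.1 𝒱 k) :
    uvProj G n P 𝒲 ≫ (relativeHomology G n).map (vietorisPairMap k hk') =
      uvProj G n P 𝒰 ≫ (relativeHomology G n).map (vietorisPairMap k hk) := by
  have hw : uvProj G n P 𝒲 ≫ (relativeHomology G n).map
      (vietorisPairMap id (isSimplicialPairMap_id P hle)) = uvProj G n P 𝒰 :=
    limit.w (vietorisSystem G n P) (homOfLE hle).op
  have hc : vietorisPairMap id (isSimplicialPairMap_id P hle) ≫ vietorisPairMap k hk =
      vietorisPairMap k hk' := rfl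
  rw [← hw, Category.assoc, ← Functor.map_comp, hc]

/-- The homomorphism of uniform Vietoris homology induced by a morphism `f` of uniform pairs:
its component at `𝒱` is `H_n(f) ∘ π_{f⁻¹𝒱}`. -/
def uvMap (G : Type u) [AddCommGroup G] (n : ℕ) {P Q : UPair.{u}} (f : P ⟶ Q) :
    uvHomology G n P ⟶ uvHomology G n Q :=
  limit.lift (vietorisSystem G n Q)
    { pt := uvHomology G n P
      π :=
        { app := fun 𝒱 => uvProj G n P (𝒱.unop.preimage f) ≫
            (relativeHomology G n).map
              (vietorisPairMap f.toFun (isSimplicialPairMap_preimage f 𝒱.unop))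
          naturality := by
            intro 𝒱 𝒲 h
            have hle : 𝒲.unop.preimage f ≤ 𝒱.unop.preimage f := by
              rintro _ ⟨T, hT, rfl⟩
              obtain ⟨S, hS, hTS⟩ := h.unop.le T hT
              exact ⟨_, ⟨S, hS, rfl⟩, Set.preimage_mono hTS⟩
            have h₁ := (isSimplicialPairMap_id Q h.unop.le).comp
              (isSimplicialPairMap_preimage f 𝒱.unop)
            have key := uvProj_comp_map (k := id ∘ f.toFun) G n hle
              (isSimplicialPairMap_preimage f 𝒲.unop) h₁
            rw [← vietorisPairMap_comp (isSimplicialPairMap_id Q h.unop.le)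
              (isSimplicialPairMap_preimage f 𝒱.unop), Functor.map_comp,
              ← Category.assoc] at key
            exact (Category.id_comp _).trans key.symm } }

theorem uvMap_proj (G : Type u) [AddCommGroup G] (n : ℕ) {P Q : UPair.{u}} (f : P ⟶ Q)
    (𝒱 : UCov Q.carrier) :
    uvMap G n f ≫ uvProj G n Q 𝒱 = uvProj G n P (𝒱.preimage f) ≫ (relativeHomology G n).map
      (vietorisPairMap f.toFun (isSimplicialPairMap_preimage f 𝒱)) :=
  limit.lift_π _ _

/-- Uniform Vietoris homology `Ȟᵘ_n(-; G)` as a functor on uniform pairs. -/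
def uniformVietorisHomology (G : Type u) [AddCommGroup G] (n : ℕ) :
    UPair.{u} ⥤ AddCommGrpCat.{u} where
  obj := uvHomology G n
  map := uvMap G n
  map_id P := by
    refine limit.hom_ext fun 𝒱 => ?_
    have hle : 𝒱.unop ≤ 𝒱.unop.preimage (𝟙 P) := by
      rintro _ ⟨T, hT, rfl⟩
      exact ⟨T, hT, subset_rfl⟩
    exact ((uvMap_proj G n (𝟙 P) 𝒱.unop).trans
      (limit.w (vietorisSystem G n P) (homOfLE hle).op)).trans (Category.id_comp _).symm
  map_comp {P Q R} f g := by
    refine limit.hom_ext fun 𝒱 => ?_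
    have hle : 𝒱.unop.preimage (f ≫ g) ≤ (𝒱.unop.preimage g).preimage f := by
      rintro _ ⟨_, ⟨T, hT, rfl⟩, rfl⟩
      exact ⟨_, ⟨T, hT, rfl⟩, subset_rfl⟩
    have key := uvProj_comp_map G n hle (isSimplicialPairMap_preimage (f ≫ g) 𝒱.unop)
      ((isSimplicialPairMap_preimage g 𝒱.unop).comp
        (isSimplicialPairMap_preimage f (𝒱.unop.preimage g)))
    have h₃ : (uvMap G n f ≫ uvMap G n g) ≫ uvProj G n R 𝒱.unop =
        uvProj G n P ((𝒱.unop.preimage g).preimage f) ≫ (relativeHomology G n).map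
          (vietorisPairMap f.toFun (isSimplicialPairMap_preimage f (𝒱.unop.preimage g)) ≫
            vietorisPairMap g.toFun (isSimplicialPairMap_preimage g 𝒱.unop)) := by
      rw [Category.assoc, uvMap_proj, ← Category.assoc, uvMap_proj, Category.assoc,
        Functor.map_comp]
    exact (uvMap_proj G n (f ≫ g) 𝒱.unop).trans (key.symm.trans h₃.symm)

/-! ## The nonstandard universe -/

/-- The relation symbols of the language of set theory: one binary symbol. -/
inductive SetLangRel : ℕ → Type where
  | mem : SetLangRel 2

/-- The first-order language of set theory. -/
def setLanguage : FirstOrder.Language.{0, 0} := ⟨fun _ => Empty, SetLangRel⟩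

/-- The membership symbol. -/
abbrev memSymbol : setLanguage.Relations 2 := SetLangRel.mem

/-- The membership relation of a structure for the language of set theory. -/
def SetMem {M : Type v} [setLanguage.Structure M] (x y : M) : Prop :=
  FirstOrder.Language.Structure.RelMap memSymbol ![x, y]

/-- The standard universe `𝕌`: the ZFC sets of Mathlib (over a universe of types) with their
membership relation. It is a model of ZFC that contains a copy of every type of the universe `u`
and of all structures on it. -/
instance : setLanguage.Structure ZFSet.{u} where
  funMap f := nomatch f
  RelMap | .mem => fun x => x 0 ∈ x 1

/-- `M` is `κ`-saturated: every set of formulas in one variable, with parameters from a set of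
fewer than `κ` elements of `M`, which is finitely satisfiable in `M` is realised in `M`. -/
def IsSaturated (L : FirstOrder.Language.{0, 0}) (M : Type v) [L.Structure M]
    (κ : Cardinal.{w}) : Prop :=
  ∀ A : Set M, Cardinal.lift.{w} (Cardinal.mk A) < Cardinal.lift.{v} κ → ∀ p : Set (L.Formula (A ⊕ Unit)),
    (∀ q : Finset (L.Formula (A ⊕ Unit)), (q : Set _) ⊆ p →
      ∃ m : M, ∀ φ ∈ q, φ.Realize (Sum.elim Subtype.val fun _ => m)) →
    ∃ m : M, ∀ φ ∈ p, φ.Realize (Sum.elim Subtype.val fun _ => m)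

set_option linter.checkUnivs false in
/-- A nonstandard universe `*𝕌`: a `|𝕌|⁺`-saturated elementary extension of `𝕌`. -/
structure NonstandardUniverse where
  carrier : Type v
  [str : setLanguage.Structure carrier]
  star : ZFSet.{u} ↪ₑ[setLanguage] carrier
  saturated : IsSaturated setLanguage carrier (Order.succ (Cardinal.mk ZFSet.{u}))

attribute [instance] NonstandardUniverse.str

/-- `p` is the (Kuratowski) ordered pair `{{x}, {x, y}}`, in a structure for the language of set
theory. -/
def IsPair {M : Type v} [setLanguage.Structure M] (p x y : M) : Prop :=
  ∀ w, SetMem w p ↔ (∀ z, SetMem z w ↔ z = x) ∨ (∀ z, SetMem z w ↔ (z = x ∨ z = y))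

/-- The ordered pair of `x` and `y` belongs to `m`. -/
def PairMem {M : Type v} [setLanguage.Structure M] (m x y : M) : Prop :=
  ∃ p, IsPair p x y ∧ SetMem p m

/-! ### First-order formulas for membership and ordered pairs (used for transfer) -/

namespace SetFormula

open FirstOrder.Language

variable {α : Type} {n : ℕ} {M : Type v} [setLanguage.Structure M]

/-- A variable, seen below one more quantifier. -/
def up (i : α ⊕ Fin n) : α ⊕ Fin (n + 1) := Sum.map id Fin.castSucc i

/-- The innermost bound variable. -/
def new : α ⊕ Fin (n + 1) := Sum.inr (Fin.last n)

def memF (i j : α ⊕ Fin n) : setLanguage.BoundedFormula α n :=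
  memSymbol.boundedFormula₂ (.var i) (.var j)

def eqF (i j : α ⊕ Fin n) : setLanguage.BoundedFormula α n :=
  .equal (.var i) (.var j)

def isPairF (p x y : α ⊕ Fin n) : setLanguage.BoundedFormula α n :=
  ∀' (memF new (up p) ⇔
    ((∀' (memF new (up new) ⇔ eqF new (up (up x)))) ⊔
      (∀' (memF new (up new) ⇔ (eqF new (up (up x)) ⊔ eqF new (up (up y)))))))

def pairMemF (m x y : α ⊕ Fin n) : setLanguage.BoundedFormula α n :=
  ∃' (isPairF new (up x) (up y) ⊓ memF new (up m))

variable (v : α → M) (xs : Fin n → M)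

@[simp] theorem elim_up {M : Type v} (v : α → M) (xs : Fin n → M) (a : M) (i : α ⊕ Fin n) :
    Sum.elim v (Fin.snoc xs a : Fin (n + 1) → M) (up i) = Sum.elim v xs i := by
  rcases i with i | i <;> simp [up]

@[simp] theorem elim_new {M : Type v} (v : α → M) (xs : Fin n → M) (a : M) :
    Sum.elim v (Fin.snoc xs a : Fin (n + 1) → M) new = a := by
  simp [new]

@[simp] theorem realize_memF (i j : α ⊕ Fin n) :
    (memF i j).Realize v xs ↔ SetMem (Sum.elim v xs i) (Sum.elim v xs j) := by
  simp [SetMem, memF, BoundedFormula.realize_rel₂]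

@[simp] theorem realize_eqF (i j : α ⊕ Fin n) :
    (eqF i j).Realize v xs ↔ Sum.elim v xs i = Sum.elim v xs j := Iff.rfl

@[simp] theorem realize_isPairF (p x y : α ⊕ Fin n) :
    (isPairF p x y).Realize v xs ↔
      IsPair (Sum.elim v xs p) (Sum.elim v xs x) (Sum.elim v xs y) := by
  simp [isPairF, IsPair]

@[simp] theorem realize_pairMemF (m x y : α ⊕ Fin n) :
    (pairMemF m x y).Realize v xs ↔
      PairMem (Sum.elim v xs m) (Sum.elim v xs x) (Sum.elim v xs y) := by
  simp [pairMemF, PairMem]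

end SetFormula

theorem setMem_zfset (x y : ZFSet.{u}) : SetMem x y ↔ x ∈ y := Iff.rfl

theorem isPair_zfset (p x y : ZFSet.{u}) : IsPair p x y ↔ p = ZFSet.pair x y := by
  have h₁ : ∀ w : ZFSet.{u}, (∀ z, SetMem z w ↔ z = x) ↔ w = {x} := fun w => by
    simp only [ZFSet.ext_iff, setMem_zfset, ZFSet.mem_singleton]
  have h₂ : ∀ w : ZFSet.{u}, (∀ z, SetMem z w ↔ (z = x ∨ z = y)) ↔ w = {x, y} := fun w => by
    simp only [ZFSet.ext_iff, setMem_zfset, ZFSet.mem_pair]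
  simp only [IsPair, h₁, h₂]
  simp only [ZFSet.ext_iff (x := p), ZFSet.pair, ZFSet.mem_pair, setMem_zfset]

theorem pairMem_zfset (m x y : ZFSet.{u}) : PairMem m x y ↔ ZFSet.pair x y ∈ m := by
  simp [PairMem, isPair_zfset, setMem_zfset]

/-! ### Sets of the standard universe representing types, subsets and relations -/

theorem exists_code (X : Type w) [Small.{u} X] : Nonempty (X ↪ ZFSet.{u}) := by
  let r := @WellOrderingRel (Shrink.{u} X)
  refine ⟨(equivShrink X).toEmbedding.trans ⟨fun x => (Ordinal.typein r x).toZFSet, ?_⟩⟩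
  exact Ordinal.toZFSet_injective.comp (Ordinal.typein_injective r)

/-- A choice of sets in the standard universe representing the elements of the type `X`. -/
def code (X : Type w) [Small.{u} X] : X ↪ ZFSet.{u} := (exists_code X).some

/-- The set representing a subset `A` of `X`. -/
def setCode {X : Type w} [Small.{u} X] (A : Set X) : ZFSet.{u} :=
  ZFSet.range fun a : A => code X a.1

/-- The set of ordered pairs representing a relation between `X` and `Y`. -/
def relCode {X : Type w} {Y : Type w} [Small.{u} X] [Small.{u} Y] (R : X → Y → Prop) :
    ZFSet.{u} :=
  ZFSet.range fun p : {p : X × Y // R p.1 p.2} => ZFSet.pair (code X p.1.1) (code Y p.1.2)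

theorem mem_setCode {X : Type w} [Small.{u} X] (A : Set X) (z : ZFSet.{u}) :
    z ∈ setCode A ↔ ∃ a ∈ A, code X a = z := by
  simp [setCode]

theorem code_mem_setCode {X : Type w} [Small.{u} X] (A : Set X) (x : X) :
    code.{u} X x ∈ setCode A ↔ x ∈ A := by
  simp [mem_setCode]

theorem mem_relCode {X Y : Type w} [Small.{u} X] [Small.{u} Y] (R : X → Y → Prop)
    (z : ZFSet.{u}) :
    z ∈ relCode R ↔ ∃ x y, R x y ∧ ZFSet.pair (code X x) (code Y y) = z := by
  simp [relCode]

theorem pair_mem_relCode {X Y : Type w} [Small.{u} X] [Small.{u} Y] (R : X → Y → Prop)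
    (x : X) (y : Y) : ZFSet.pair (code.{u} X x) (code.{u} Y y) ∈ relCode.{u} R ↔ R x y := by
  simp [relCode, ZFSet.pair_inj]

namespace NonstandardUniverse

variable (N : NonstandardUniverse.{u, v})

/-- The nonstandard extension `*X` of a type `X`. -/
def Ext (X : Type w) [Small.{u} X] : Type v :=
  {m : N.carrier // SetMem m (N.star (setCode (Set.univ : Set X)))}

variable {N} {X Y Z : Type w} [Small.{u} X] [Small.{u} Y] [Small.{u} Z]

/-- The nonstandard extension `*A ⊆ *X` of a subset `A ⊆ X`. -/
def extSet (A : Set X) : Set (N.Ext X) := {x | SetMem x.1 (N.star (setCode A))}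

/-- The nonstandard extension `*R` of a relation `R`. -/
def extRel (R : X → Y → Prop) (x : N.Ext X) (y : N.Ext Y) : Prop :=
  PairMem (N.star (relCode R)) x.1 y.1

theorem star_mem {x y : ZFSet.{u}} : SetMem (N.star x) (N.star y) ↔ x ∈ y := by
  have h := N.star.map_formula
    (SetFormula.memF (Sum.inl 0) (Sum.inl 1) : setLanguage.Formula (Fin 2)) ![x, y]
  simpa [FirstOrder.Language.Formula.Realize, setMem_zfset] using h

/-- The standard element of `*X` given by an element of `X`. -/
def pt (N : NonstandardUniverse.{u, v}) (x : X) : N.Ext X :=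
  ⟨N.star (code X x), star_mem.2 ((code_mem_setCode _ _).2 trivial)⟩

/-- A map `*X → *Y` is internal if its graph is given by an element of `*𝕌`. -/
def Internal (f : N.Ext X → N.Ext Y) : Prop :=
  ∃ m : N.carrier, ∀ x y, PairMem m x.1 y.1 ↔ f x = y

/-- The relation `≈` of infinite closeness on `*X`: `(x, y) ∈ *U` for every entourage `U`. -/
def Near [UniformSpace X] (x y : N.Ext X) : Prop :=
  ∀ U ∈ 𝓤 X, extRel (fun a b => (a, b) ∈ U) x y

/-- S-continuity of a map `*X → *Y`. -/
def SContinuous [UniformSpace X] [UniformSpace Y] (f : N.Ext X → N.Ext Y) : Prop :=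
  ∀ x x', Near x x' → Near (f x) (f x')

/-! ### Transfer of the basic facts about graphs of maps -/

section transfer

open FirstOrder.Language SetFormula

theorem internal_id : Internal (id : N.Ext X → N.Ext X) := by
  refine ⟨N.star (relCode fun a b : X => a = b), fun x y => ?_⟩
  have h := N.star.map_formula
    (∀' (memF new (Sum.inl 1) ⟹ ∀' (memF new (Sum.inl 1) ⟹
      (pairMemF (Sum.inl 0) (up new) new ⇔ eqF (up new) new))) : setLanguage.Formula (Fin 2))
    ![relCode fun a b : X => a = b, setCode (Set.univ : Set X)]
  simp only [Formula.Realize, BoundedFormula.realize_all, BoundedFormula.realize_imp,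
    BoundedFormula.realize_iff, realize_memF, realize_pairMemF, realize_eqF, elim_up, elim_new,
    Sum.elim_inl, Function.comp_apply, Matrix.cons_val_zero, Matrix.cons_val_one,
    setMem_zfset, pairMem_zfset, mem_setCode] at h
  refine h.2 ?_ x.1 x.2 y.1 y.2 |>.trans Subtype.ext_iff.symm
  rintro _ ⟨a, -, rfl⟩ _ ⟨b, -, rfl⟩
  simp [pair_mem_relCode]

theorem Internal.comp {g : N.Ext Y → N.Ext Z} {f : N.Ext X → N.Ext Y} (hg : Internal g)
    (hf : Internal f) : Internal (g ∘ f) := by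
  obtain ⟨mf, hf⟩ := hf
  obtain ⟨mg, hg⟩ := hg
  have h := N.star.map_formula
    (∀' ∀' ∃' ∀' (memF new (Sum.inl 0) ⟹ ∀' (memF new (Sum.inl 2) ⟹
      (pairMemF (up (up new)) (up new) new ⇔ ∃' (memF new (Sum.inl 1) ⊓
        (pairMemF (up (up (up (up (up new))))) (up (up new)) new ⊓
          pairMemF (up (up (up (up new)))) new (up new)))))) : setLanguage.Formula (Fin 3))
    ![setCode (Set.univ : Set X), setCode (Set.univ : Set Y), setCode (Set.univ : Set Z)]
  simp only [Formula.Realize, BoundedFormula.realize_all, BoundedFormula.realize_imp,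
    BoundedFormula.realize_iff, BoundedFormula.realize_ex, BoundedFormula.realize_inf,
    realize_memF, realize_pairMemF, realize_eqF, elim_up, elim_new,
    Sum.elim_inl, Function.comp_apply, Matrix.cons_val_zero, Matrix.cons_val_one,
    Matrix.cons_val, setMem_zfset, pairMem_zfset] at h
  obtain ⟨m, hm⟩ := h.2 (fun F G => by
    refine ⟨ZFSet.pairSep (fun x z => ∃ y ∈ setCode (Set.univ : Set Y),
      ZFSet.pair x y ∈ F ∧ ZFSet.pair y z ∈ G) (setCode (Set.univ : Set X))
      (setCode (Set.univ : Set Z)), fun x hx z hz => ?_⟩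
    rw [ZFSet.mem_pairSep]
    constructor
    · rintro ⟨x', -, z', -, he, h⟩
      obtain ⟨rfl, rfl⟩ := ZFSet.pair_inj.1 he
      exact h
    · exact fun h => ⟨x, hx, z, hz, rfl, h⟩) mf mg
  refine ⟨m, fun x z => (hm x.1 x.2 z.1 z.2).trans ?_⟩
  constructor
  · rintro ⟨y, hy, h₁, h₂⟩
    have h₁ := (hf x ⟨y, hy⟩).1 h₁
    have h₂ := (hg ⟨y, hy⟩ z).1 h₂
    rw [Function.comp_apply, h₁, h₂]
  · intro h
    exact ⟨(f x).1, (f x).2, (hf _ _).2 rfl, (hg _ _).2 h⟩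

theorem existsUnique_extRel (N : NonstandardUniverse.{u, v}) (f : X → Y) (x : N.Ext X) :
    ∃ y : N.Ext Y, ∀ y', extRel (fun a b => f a = b) x y' ↔ y = y' := by
  have h := N.star.map_formula
    (∀' (memF new (Sum.inl 1) ⟹ ∃' (memF new (Sum.inl 2) ⊓ ∀' (memF new (Sum.inl 2) ⟹
      (pairMemF (Sum.inl 0) (up (up new)) new ⇔ eqF (up new) new)))) :
        setLanguage.Formula (Fin 3))
    ![relCode fun a b => f a = b, setCode (Set.univ : Set X), setCode (Set.univ : Set Y)]
  simp only [Formula.Realize, BoundedFormula.realize_all, BoundedFormula.realize_imp,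
    BoundedFormula.realize_iff, BoundedFormula.realize_ex, BoundedFormula.realize_inf,
    realize_memF, realize_pairMemF, realize_eqF, elim_up, elim_new,
    Sum.elim_inl, Function.comp_apply, Matrix.cons_val_zero, Matrix.cons_val_one,
    Matrix.cons_val, setMem_zfset, pairMem_zfset, mem_setCode] at h
  obtain ⟨y, hy, h'⟩ := h.2 (by
    rintro _ ⟨a, -, rfl⟩
    refine ⟨code Y (f a), ⟨f a, trivial, rfl⟩, ?_⟩
    rintro _ ⟨b, -, rfl⟩
    simp [pair_mem_relCode]) x.1 x.2
  exact ⟨⟨y, hy⟩, fun y' =>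
    (h' y'.1 y'.2).trans (Subtype.ext_iff (a1 := ⟨y, hy⟩) (a2 := y')).symm⟩

/-- The nonstandard extension `*f : *X → *Y` of a map `f : X → Y`. -/
def extMap (N : NonstandardUniverse.{u, v}) (f : X → Y) (x : N.Ext X) : N.Ext Y :=
  (existsUnique_extRel N f x).choose

theorem extRel_graph_iff (f : X → Y) (x : N.Ext X) (y : N.Ext Y) :
    extRel (fun a b => f a = b) x y ↔ extMap N f x = y :=
  (existsUnique_extRel N f x).choose_spec y

theorem internal_extMap (f : X → Y) : Internal (extMap N f) :=
  ⟨N.star (relCode fun a b => f a = b), extRel_graph_iff f⟩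

theorem extMap_mem {f : X → Y} {A : Set X} {B : Set Y} (hf : Set.MapsTo f A B) :
    Set.MapsTo (extMap N f) (extSet A) (extSet B) := by
  intro x hx
  have h := N.star.map_formula
    (∀' (memF new (Sum.inl 1) ⟹ ∀' (pairMemF (Sum.inl 0) (up new) new ⟹
      memF new (Sum.inl 2))) : setLanguage.Formula (Fin 3))
    ![relCode fun a b => f a = b, setCode A, setCode B]
  simp only [Formula.Realize, BoundedFormula.realize_all, BoundedFormula.realize_imp,
    realize_memF, realize_pairMemF, elim_up, elim_new,
    Sum.elim_inl, Function.comp_apply, Matrix.cons_val_zero, Matrix.cons_val_one,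
    Matrix.cons_val, setMem_zfset, pairMem_zfset, mem_setCode] at h
  refine h.2 ?_ x.1 hx _ ((extRel_graph_iff f x _).2 rfl)
  rintro _ ⟨a, ha, rfl⟩ y hy
  obtain ⟨a', b, rfl, he⟩ := (mem_relCode _ _).1 hy
  obtain ⟨h₁, rfl⟩ := ZFSet.pair_inj.1 he
  obtain rfl := (code X).injective h₁
  exact ⟨_, hf ha, rfl⟩

theorem extMap_rel {f : X → Y} {R : X → X → Prop} {S : Y → Y → Prop}
    (hf : ∀ a a', R a a' → S (f a) (f a')) (x x' : N.Ext X) (hx : extRel R x x') :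
    extRel S (extMap N f x) (extMap N f x') := by
  have h := N.star.map_formula
    (∀' ∀' (pairMemF (Sum.inl 1) (up new) new ⟹ ∀' ∀'
      (pairMemF (Sum.inl 0) (up (up (up new))) (up new) ⟹
        pairMemF (Sum.inl 0) (up (up new)) new ⟹
          pairMemF (Sum.inl 2) (up new) new)) : setLanguage.Formula (Fin 3))
    ![relCode fun a b => f a = b, relCode R, relCode S]
  simp only [Formula.Realize, BoundedFormula.realize_all, BoundedFormula.realize_imp,
    realize_memF, realize_pairMemF, elim_up, elim_new,
    Sum.elim_inl, Function.comp_apply, Matrix.cons_val_zero, Matrix.cons_val_one,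
    Matrix.cons_val, setMem_zfset, pairMem_zfset] at h
  refine h.2 ?_ x.1 x'.1 hx _ _ ((extRel_graph_iff f x _).2 rfl)
    ((extRel_graph_iff f x' _).2 rfl)
  intro a a' haa y y' hy hy'
  obtain ⟨a, a', hR, he⟩ := (mem_relCode _ _).1 haa
  obtain ⟨rfl, rfl⟩ := ZFSet.pair_inj.1 he
  obtain ⟨c, b, rfl, he⟩ := (mem_relCode _ _).1 hy
  obtain ⟨h₁, rfl⟩ := ZFSet.pair_inj.1 he
  obtain rfl := (code X).injective h₁
  obtain ⟨c', b', rfl, he⟩ := (mem_relCode _ _).1 hy'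
  obtain ⟨h₂, rfl⟩ := ZFSet.pair_inj.1 he
  obtain rfl := (code X).injective h₂
  exact (pair_mem_relCode S _ _).2 (hf _ _ hR)

theorem extMap_id : extMap N (id : X → X) = id := by
  funext x
  refine (extRel_graph_iff id x x).1 ?_
  have h := N.star.map_formula
    (∀' (memF new (Sum.inl 1) ⟹ pairMemF (Sum.inl 0) new new) : setLanguage.Formula (Fin 2))
    ![relCode fun a b : X => id a = b, setCode (Set.univ : Set X)]
  simp only [Formula.Realize, BoundedFormula.realize_all, BoundedFormula.realize_imp,
    realize_memF, realize_pairMemF, elim_new,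
    Sum.elim_inl, Function.comp_apply, Matrix.cons_val_zero, Matrix.cons_val_one,
    setMem_zfset, pairMem_zfset, mem_setCode] at h
  refine h.2 ?_ x.1 x.2
  rintro _ ⟨a, -, rfl⟩
  exact (pair_mem_relCode _ _ _).2 rfl

theorem extMap_comp (g : Y → Z) (f : X → Y) :
    extMap N (g ∘ f) = extMap N g ∘ extMap N f := by
  funext x
  refine (extRel_graph_iff (g ∘ f) x _).1 ?_
  have h := N.star.map_formula
    (∀' ∀' (pairMemF (Sum.inl 0) (up new) new ⟹ ∀'
      (pairMemF (Sum.inl 1) (up new) new ⟹ pairMemF (Sum.inl 2) (up (up new)) new)) :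
        setLanguage.Formula (Fin 3))
    ![relCode fun a b => f a = b, relCode fun a b => g a = b, relCode fun a b => (g ∘ f) a = b]
  simp only [Formula.Realize, BoundedFormula.realize_all, BoundedFormula.realize_imp,
    realize_memF, realize_pairMemF, elim_up, elim_new,
    Sum.elim_inl, Function.comp_apply, Matrix.cons_val_zero, Matrix.cons_val_one,
    Matrix.cons_val, setMem_zfset, pairMem_zfset] at h
  refine h.2 ?_ x.1 (extMap N f x).1 ((extRel_graph_iff f x _).2 rfl) _
    ((extRel_graph_iff g _ _).2 rfl)
  intro x y hxy z hyz
  obtain ⟨a, b, rfl, he⟩ := (mem_relCode _ _).1 hxy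
  obtain ⟨rfl, rfl⟩ := ZFSet.pair_inj.1 he
  obtain ⟨c, b', rfl, he⟩ := (mem_relCode _ _).1 hyz
  obtain ⟨h₁, rfl⟩ := ZFSet.pair_inj.1 he
  obtain rfl := (code Y).injective h₁
  exact (pair_mem_relCode _ _ _).2 rfl

theorem sContinuous_extMap [UniformSpace X] [UniformSpace Y] {f : X → Y}
    (hf : UniformContinuous f) : SContinuous (extMap N f) :=
  fun x x' hx V hV => extMap_rel (R := fun a b => (f a, f b) ∈ V) (fun _ _ h => h) x x'
    (hx _ (hf hV))

end transfer

end NonstandardUniverse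

/-! ## S-continuous maps of uniform pairs and S-homotopy -/

open NonstandardUniverse

/-- The objects of the category `UPair_S`: uniform pairs. -/
structure UPairS (N : NonstandardUniverse.{u, v}) : Type (u + 1) where
  of ::
  as : UPair.{u}

/-- The morphisms of `UPair_S`: internal S-continuous maps `*X → *Y` carrying `*A` into `*B`. -/
@[ext]
structure UPairS.Hom {N : NonstandardUniverse.{u, v}} (P Q : UPairS N) : Type v where
  toFun : N.Ext P.as.carrier → N.Ext Q.as.carrier
  internal : Internal toFun
  sContinuous : SContinuous toFun
  mapsTo : Set.MapsTo toFun (extSet P.as.sub) (extSet Q.as.sub)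

/-- The category `UPair_S` of uniform pairs and S-continuous maps between their nonstandard
extensions. -/
instance (N : NonstandardUniverse.{u, v}) : Category (UPairS N) where
  Hom := UPairS.Hom
  id P := ⟨id, internal_id, fun _ _ h => h, Set.mapsTo_id _⟩
  comp f g := ⟨g.toFun ∘ f.toFun, g.internal.comp f.internal,
    fun _ _ h => g.sContinuous _ _ (f.sContinuous _ _ h), g.mapsTo.comp f.mapsTo⟩

/-- The embedding `UPair ⥤ UPair_S` sending `f` to its nonstandard extension `*f`. -/
def starFunctor (N : NonstandardUniverse.{u, v}) : UPair.{u} ⥤ UPairS N where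
  obj P := ⟨P⟩
  map f := ⟨extMap N f.toFun, internal_extMap _, sContinuous_extMap f.uniformContinuous,
    extMap_mem f.mapsTo⟩
  map_id _ := UPairS.Hom.ext extMap_id
  map_comp f g := UPairS.Hom.ext (extMap_comp g.toFun f.toFun)

/-- The category `pUPair_S` of precompact uniform pairs and S-continuous maps between their
nonstandard extensions. -/
abbrev PUPairS (N : NonstandardUniverse.{u, v}) : Type (u + 1) :=
  ObjectProperty.FullSubcategory (fun P : UPairS N => IsPrecompactPair P.as)

/-- The embedding `pUPair ⥤ pUPair_S` sending `f` to its nonstandard extension `*f`. -/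
def pStarFunctor (N : NonstandardUniverse.{u, v}) : PUPair.{u} ⥤ PUPairS N :=
  ObjectProperty.lift _ (IsPrecompactPair.ι ⋙ starFunctor N) fun P => P.property

/-- The hyperreal interval `*[0, T] = {t ∈ *ℝ | 0 ≤ t ≤ T}`. -/
def HyperInterval {N : NonstandardUniverse.{u, v}} (T : N.Ext ℝ) : Type v :=
  {t : N.Ext ℝ // extRel (· ≤ ·) (N.pt 0) t ∧ extRel (· ≤ ·) t T}

/-- `h` is an `S_T`-homotopy between the S-continuous maps `f, g : *(X, A) → *(Y, B)`: an
internal S-continuous map `*(X, A) × *[0, T] → *(Y, B)` with `h(·, 0) = f` and `h(·, T) = g`. -/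
structure IsSHomotopy {N : NonstandardUniverse.{u, v}} {P Q : UPairS N} (f g : P ⟶ Q)
    (T : N.Ext ℝ) (h : N.Ext P.as.carrier → HyperInterval T → N.Ext Q.as.carrier) : Prop where
  /-- `h` is internal: its graph, a set of pairs `((x, t), y)`, is given by an element of `*𝕌`. -/
  internal : ∃ m : N.carrier, ∀ x t y,
    (∃ q, IsPair q x.1 t.1.1 ∧ PairMem m q y.1) ↔ h x t = y
  sContinuous : ∀ x x' t t', Near x x' → Near t.1 t'.1 → Near (h x t) (h x' t')
  mapsTo : ∀ x ∈ extSet P.as.sub, ∀ t, h x t ∈ extSet Q.as.sub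
  map_zero : ∀ x t, t.1 = N.pt 0 → h x t = f.toFun x
  map_end : ∀ x t, t.1 = T → h x t = g.toFun x

/-- S-continuous maps are `S_•`-homotopic if they are `S_T`-homotopic for some hyperreal
`T ≥ 0`. -/
def SBulletHomotopic {N : NonstandardUniverse.{u, v}} {P Q : UPairS N} (f g : P ⟶ Q) : Prop :=
  ∃ T : N.Ext ℝ, extRel (· ≤ ·) (N.pt 0) T ∧ ∃ h, IsSHomotopy f g T h

/-! ## The homomorphism induced by an S-continuous map -/

/-- `k : (X, A) → (Y, B)` is a `W`-preshadow of the S-continuous map `f : *(X, A) → *(Y, B)` of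
precompact pairs, where `W` is an entourage of `Y`: it is uniformly `W`-continuous, and
`(*k(x), f(x)) ∈ *W` for all `x ∈ *X`. -/
structure IsPreshadow {N : NonstandardUniverse.{u, v}} {P Q : UPairS N} (f : P ⟶ Q)
    (W : Set (Q.as.carrier × Q.as.carrier)) (k : P.as.carrier → Q.as.carrier) : Prop where
  mapsTo : Set.MapsTo k P.as.sub Q.as.sub
  uniformlyContinuous : ∃ U ∈ 𝓤 P.as.carrier, ∀ x y, (x, y) ∈ U → (k x, k y) ∈ W
  close : ∀ x, extRel (fun a b => (a, b) ∈ W) (extMap N k x) (f.toFun x)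

/-- `φ : Ȟᵘ_n(X, A; G) → Ȟᵘ_n(Y, B; G)` is induced by the S-continuous map `f`: for every uniform
cover `𝒱` of `Y`, refined by `{V[y] | y ∈ Y}` with `V` an entourage, every entourage `W` with
`W² ⊆ V`, every `W`-preshadow `k` of `f`, and every uniform cover `𝒰` of `X` such that `k` is a
simplicial map `(X_𝒰, A_𝒰) → (Y_𝒱, B_𝒱)`, one has `π_𝒱 ∘ φ = H_n(k) ∘ π_𝒰`. -/
def IsInducedBy {N : NonstandardUniverse.{u, v}} (G : Type u) [AddCommGroup G] (n : ℕ)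
    {P Q : UPairS N} (f : P ⟶ Q) (φ : uvHomology G n P.as ⟶ uvHomology G n Q.as) : Prop :=
  ∀ (𝒱 : UCov Q.as.carrier) (V W : Set (Q.as.carrier × Q.as.carrier)),
    V ∈ 𝓤 Q.as.carrier → Refines (ballCover V) 𝒱.1 → W ∈ 𝓤 Q.as.carrier →
    (∀ x y z, (x, y) ∈ W → (y, z) ∈ W → (x, z) ∈ V) →
    ∀ k, IsPreshadow f W k →
    ∀ (𝒰 : UCov P.as.carrier) (hk : IsSimplicialPairMap P.as Q.as 𝒰.1 𝒱.1 k),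
      φ ≫ uvProj G n Q.as 𝒱 = uvProj G n P.as 𝒰 ≫ (relativeHomology G n).map
        (vietorisPairMap k hk)

end

/-!
Let `f : *(X, A) → *(Y, B)` be S-continuous, with `X` and `Y` precompact.

Saturation turns S-continuity into uniform continuity at each standard scale: for every entourage
`W` of `Y` there is an entourage `U` of `X` with `f × f` mapping `*U` into `*W`
(`SContinuous.exists_entourage`). Precompactness gives maps `p : X → X` and `q : Y → Y` of finite
range, close to the identity and respecting `A` and `B`. A map of finite range takes only standard
values after extension, so `*q ∘ f ∘ *p` is the extension of a standard map, which is a preshadow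
of `f`; for a fixed modulus of continuity, these preshadows range over a finite set
(`exists_finite_preshadows`).

Any preshadow of `f` can be compared with a much finer one: on a fine enough cover of `X` the two
are contiguous as maps into `Y_𝒱` (`PreshadowAt.hom_eq_of_fine`), and contiguous maps of pairs are
chain homotopic, compatibly with the subcomplexes, so that they agree in relative homology
(`relativeHomology_map_eq_of_contiguous`). Hence the components `H_n(k) ∘ π_𝒰` do not depend on
choices and define the unique induced homomorphism (`inducedMap`). Functoriality holds because fine
preshadows compose, and the extension property because a uniformly continuous map is a preshadow
of its own extension.

Let `h` be an S-homotopy over `*[0, T]`. Again by saturation there is a standard `δ > 0` such that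
slices of `h` at times differing by at most `δ` have a common preshadow, and therefore the same
component at a given cover. Since `T` may be infinite, one cannot conclude by a finite induction.
But the preshadows come from a finite set of standard maps, so the times at which the slice admits
one of those inducing the component of `f` form an internal set; the Archimedean property of `ℝ`,
transferred to internal sets, shows that it contains `T` (`IsInternalSet.archimedean_induction`,
`inducedMap_eq_of_sBulletHomotopic`).
-/

/-! ### Homotopy invariance of relative homology -/

section CokernelHomotopy

variable {C : Type u} [Category.{v} C] [Abelian C]
  {ι : Type w} {c : ComplexShape ι}

/-- Cokernels of chain maps are computed degreewise. -/
noncomputable def isColimitCokernelCoforkEval {K L : HomologicalComplex C c} (φ : K ⟶ L) (i : ι) :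
    IsColimit (CokernelCofork.ofπ (f := φ.f i) ((cokernel.π φ).f i) (by
      rw [← HomologicalComplex.comp_f, cokernel.condition, HomologicalComplex.zero_f])) :=
  CokernelCofork.mapIsColimit _ (cokernelIsCokernel φ) (HomologicalComplex.eval C c i)

theorem epi_cokernel_π_f {K L : HomologicalComplex C c} (φ : K ⟶ L) (i : ι) :
    Epi ((cokernel.π φ).f i) :=
  epi_of_isColimit_cofork (isColimitCokernelCoforkEval φ i)

/-- The morphism out of the degree `i` part of the cokernel of a chain map induced by a morphism
which vanishes on the image. -/
noncomputable def cokernelDescEval {K L : HomologicalComplex C c} (φ : K ⟶ L) {i : ι} {Z : C}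
    (g : L.X i ⟶ Z) (hg : φ.f i ≫ g = 0) : (cokernel φ).X i ⟶ Z :=
  (isColimitCokernelCoforkEval φ i).desc (CokernelCofork.ofπ g hg)

theorem cokernel_π_f_desc {K L : HomologicalComplex C c} (φ : K ⟶ L) {i : ι} {Z : C}
    (g : L.X i ⟶ Z) (hg : φ.f i ≫ g = 0) :
    (cokernel.π φ).f i ≫ cokernelDescEval φ g hg = g :=
  (isColimitCokernelCoforkEval φ i).fac _ WalkingParallelPair.one

/-- Compatible chain homotopies on the source and the target of a chain map descend to its
cokernel. -/
noncomputable def Homotopy.cokernel {K L K' L' : HomologicalComplex C c} {φ : K ⟶ L}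
    {ψ : K' ⟶ L'} {f g : K ⟶ K'} {f' g' : L ⟶ L'} (H : Homotopy f g) (H' : Homotopy f' g')
    (h : ∀ i j, H.hom i j ≫ ψ.f j = φ.f i ≫ H'.hom i j)
    {u v : Limits.cokernel φ ⟶ Limits.cokernel ψ} (hu : cokernel.π φ ≫ u = f' ≫ cokernel.π ψ)
    (hv : cokernel.π φ ≫ v = g' ≫ cokernel.π ψ) :
    Homotopy u v where
  hom i j := cokernelDescEval φ (H'.hom i j ≫ (cokernel.π ψ).f j) (by
    rw [← Category.assoc, ← h, Category.assoc, ← HomologicalComplex.comp_f, cokernel.condition,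
      HomologicalComplex.zero_f, comp_zero])
  zero i j hij := by
    have := epi_cokernel_π_f φ i
    rw [← cancel_epi ((cokernel.π φ).f i), cokernel_π_f_desc, H'.zero i j hij, zero_comp, comp_zero]
  comm i := by
    have := epi_cokernel_π_f φ i
    rw [← cancel_epi ((cokernel.π φ).f i), Preadditive.comp_add, Preadditive.comp_add,
      ← HomologicalComplex.comp_f, ← HomologicalComplex.comp_f, hu, hv, HomologicalComplex.comp_f,
      HomologicalComplex.comp_f, H'.comm i, Preadditive.add_comp, Preadditive.add_comp]
    congr 2
    · simp only [dNext, AddMonoidHom.mk'_apply, Category.assoc,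
        HomologicalComplex.Hom.comm_assoc, cokernel_π_f_desc]
    · simp only [prevD, AddMonoidHom.mk'_apply]
      rw [← Category.assoc, cokernel_π_f_desc, Category.assoc, Category.assoc,
        HomologicalComplex.Hom.comm]

end CokernelHomotopy

/-- Compatible simplicial homotopies on the source and the target of an arrow of simplicial sets
induce compatible chain homotopies. -/
theorem sSetChainComplexMap_comp {C : Type v} [Category.{w} C] [Preadditive C] [HasCoproducts.{u} C]
    {X Y X' Y' : SSet.{u}} {φ : X ⟶ Y} {ψ : X' ⟶ Y'} {f g : X ⟶ X'} {f' g' : Y ⟶ Y'}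
    (H : SimplicialObject.Homotopy f g) (H' : SimplicialObject.Homotopy f' g')
    (h : ∀ {m : ℕ} (i : Fin (m + 1)), H.h i ≫ ψ.app _ = φ.app _ ≫ H'.h i) (R : C) (p q : ℕ) :
    (H.sSetChainComplexMap R).hom p q ≫ (SSet.chainComplexMap ψ R).f q =
      (SSet.chainComplexMap φ R).f p ≫ (H'.sSetChainComplexMap R).hom p q := by
  by_cases hpq : p + 1 = q
  · subst hpq
    change SimplicialObject.Homotopy.ToChainHomotopy.hom (H.whiskerRight (sigmaConst.obj R)) _ _ ≫
        (sigmaConst.obj R).map (ψ.app (op ⦋p + 1⦌)) = (sigmaConst.obj R).map (φ.app (op ⦋p⦌)) ≫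
        SimplicialObject.Homotopy.ToChainHomotopy.hom (H'.whiskerRight (sigmaConst.obj R)) _ _
    rw [SimplicialObject.Homotopy.ToChainHomotopy.hom_eq,
      SimplicialObject.Homotopy.ToChainHomotopy.hom_eq]
    refine (Preadditive.neg_comp _ _).trans (Eq.trans ?_ (Preadditive.comp_neg _ _).symm)
    refine congrArg _ ((Preadditive.sum_comp _ _ _).trans
      (Eq.trans ?_ (Preadditive.comp_sum _ _ _).symm))
    refine Finset.sum_congr rfl fun i _ => ?_
    refine (Preadditive.zsmul_comp _ _ _).trans (Eq.trans ?_ (Preadditive.comp_zsmul _ _ _).symm)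
    exact congrArg _ (((sigmaConst.obj R).map_comp _ _).symm.trans
      ((congrArg _ (h i)).trans ((sigmaConst.obj R).map_comp _ _)))
  · rw [(H.sSetChainComplexMap R).zero _ _ hpq, (H'.sSetChainComplexMap R).zero _ _ hpq,
      zero_comp, comp_zero]

noncomputable section

/-! ### Contiguous maps of Vietoris complexes -/

open scoped MonoidalCategory in
/-- The homotopy `V(R) × Δ[1] ⟶ V(S)` between the maps of vertices `k` and `l`. It exists as soon as
`k` and `l` are contiguous: they carry each simplex of `V(R)` into a common simplex of `V(S)`. -/
def vietorisHomotopyMap {α β : Type u} {γ δ : Type w} {R : α → γ → Prop} {S : β → δ → Prop}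
    (k l : α → β)
    (h : ∀ (p : ℕ) (a : Fin (p + 1) → α), (∃ c, ∀ i, R (a i) c) →
      ∃ d, ∀ i, S (k (a i)) d ∧ S (l (a i)) d) :
    vietorisComplex R ⊗ Δ[1] ⟶ vietorisComplex S where
  app Δ := ↾fun a =>
    ⟨fun i => if (SSet.stdSimplex.objEquiv a.2).toOrderHom i = 0 then k (a.1.1 i) else l (a.1.1 i),
      by
        obtain ⟨d, hd⟩ := h _ a.1.1 a.1.2
        refine ⟨d, fun i => ?_⟩
        dsimp only
        split_ifs
        exacts [(hd i).1, (hd i).2]⟩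
  naturality _ _ _ := rfl

/-- Contiguous maps of vertices induce homotopic maps of Vietoris complexes. -/
def vietorisHomotopy {α β : Type u} {γ δ : Type w} {R : α → γ → Prop} {S : β → δ → Prop}
    (k l : α → β) (hk hl)
    (h : ∀ (p : ℕ) (a : Fin (p + 1) → α), (∃ c, ∀ i, R (a i) c) →
      ∃ d, ∀ i, S (k (a i)) d ∧ S (l (a i)) d) :
    SSet.Homotopy (vietorisComplexMap (R := R) (S := S) k hk) (vietorisComplexMap l hl) where
  h := vietorisHomotopyMap k l h
  h₀ := rfl
  h₁ := rfl
  rel := by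
    refine NatTrans.ext (funext fun Δ => ?_)
    ext x
    exact x.1.2.elim

/-- Contiguous maps of pairs induce the same map in relative homology: the homotopy on `X_𝒰`
restricts to the one on `A_𝒰`, so it descends to the relative chains. -/
theorem relativeHomology_map_eq_of_contiguous (G : Type u) [AddCommGroup G] (n : ℕ)
    {P Q : UPair.{u}} {𝒰 : Set (Set P.carrier)} {𝒱 : Set (Set Q.carrier)}
    {k l : P.carrier → Q.carrier} (hk : IsSimplicialPairMap P Q 𝒰 𝒱 k)
    (hl : IsSimplicialPairMap P Q 𝒰 𝒱 l)
    (h : ∀ S ∈ 𝒰, ∃ T ∈ 𝒱, ∀ x ∈ S, k x ∈ T ∧ l x ∈ T) :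
    (relativeHomology G n).map (vietorisPairMap k hk) =
      (relativeHomology G n).map (vietorisPairMap l hl) := by
  let R := AddCommGrpCat.of G
  have h₂ : ∀ (p : ℕ) (a : Fin (p + 1) → P.carrier), (∃ S : 𝒰, ∀ i, a i ∈ S.1) →
      ∃ T : 𝒱, ∀ i, k (a i) ∈ T.1 ∧ l (a i) ∈ T.1 := fun p a ⟨S, hS⟩ =>
    let ⟨T, hT, hST⟩ := h S.1 S.2
    ⟨⟨T, hT⟩, fun i => hST _ (hS i)⟩
  let H₁ := (vietorisHomotopy (R := fun (a : P.sub) (S : 𝒰) => a.1 ∈ S.1)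
    (S := fun (b : Q.sub) (T : 𝒱) => b.1 ∈ T.1) (fun a => ⟨k a.1, hk.mapsTo a.2⟩)
    (fun a => ⟨l a.1, hl.mapsTo a.2⟩) (fun p a hS => (h₂ p _ hS).imp fun _ hT i => (hT i).1)
    (fun p a hS => (h₂ p _ hS).imp fun _ hT i => (hT i).2)
    fun p a hS => h₂ p _ hS).toSimplicialObjectHomotopy
  let H₂ := (vietorisHomotopy (R := fun (x : P.carrier) (S : 𝒰) => x ∈ S.1)
    (S := fun (y : Q.carrier) (T : 𝒱) => y ∈ T.1) k
    l (fun p a hS => (h₂ p _ hS).imp fun _ hT i => (hT i).1)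
    (fun p a hS => (h₂ p _ hS).imp fun _ hT i => (hT i).2) h₂).toSimplicialObjectHomotopy
  have hH : ∀ {m : ℕ} (i : Fin (m + 1)), H₁.h i ≫ (vietorisPair Q 𝒱).hom.app _ =
      (vietorisPair P 𝒰).hom.app _ ≫ H₂.h i := fun i => by
    ext x
    refine Subtype.ext (funext fun j => ?_)
    exact apply_ite Subtype.val _ _ _
  exact (Homotopy.cokernel (H₁.sSetChainComplexMap R) (H₂.sSetChainComplexMap R)
    (sSetChainComplexMap_comp (φ := (vietorisPair P 𝒰).hom) (ψ := (vietorisPair Q 𝒱).hom)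
      H₁ H₂ hH R)
    (cokernel.π_desc _ _ _) (cokernel.π_desc _ _ _)).homologyMap_eq n
end

namespace NonstandardUniverse

/-! ### Transfer -/

section Transfer

open FirstOrder.Language SetFormula

variable {N : NonstandardUniverse.{u, v}} {X Y Z : Type w} [Small.{u} X] [Small.{u} Y] [Small.{u} Z]

@[simp] theorem extRel_pt {R : X → Y → Prop} {a : X} {b : Y} :
    extRel R (N.pt a) (N.pt b) ↔ R a b := by
  have h := N.star.map_formula
    (pairMemF (Sum.inl 0) (Sum.inl 1) (Sum.inl 2) : setLanguage.Formula (Fin 3))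
    ![relCode R, code X a, code Y b]
  simp only [Formula.Realize, realize_pairMemF, Sum.elim_inl, Function.comp_apply,
    Matrix.cons_val_zero, Matrix.cons_val_one, Matrix.cons_val, pairMem_zfset,
    pair_mem_relCode] at h
  exact h

theorem pt_mem_extSet {A : Set X} {a : X} : N.pt a ∈ extSet A ↔ a ∈ A :=
  star_mem.trans (code_mem_setCode A a)

theorem extMap_pt (f : X → Y) (a : X) : extMap N f (N.pt a) = N.pt (f a) :=
  (extRel_graph_iff f _ _).1 (extRel_pt.2 rfl)

theorem extRel.trans {R : X → Y → Prop} {S : Y → Z → Prop} {Q : X → Z → Prop}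
    (h : ∀ a b c, R a b → S b c → Q a c) {x : N.Ext X} {y : N.Ext Y} {z : N.Ext Z}
    (hxy : extRel R x y) (hyz : extRel S y z) : extRel Q x z := by
  have h' := N.star.map_formula
    (∀' ∀' ∀' (pairMemF (Sum.inl 0) (up (up new)) (up new) ⟹
      pairMemF (Sum.inl 1) (up new) new ⟹ pairMemF (Sum.inl 2) (up (up new)) new) :
        setLanguage.Formula (Fin 3))
    ![relCode R, relCode S, relCode Q]
  simp only [Formula.Realize, BoundedFormula.realize_all, BoundedFormula.realize_imp,
    realize_pairMemF, elim_up, elim_new, Sum.elim_inl, Function.comp_apply, Matrix.cons_val_zero,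
    Matrix.cons_val_one, Matrix.cons_val, pairMem_zfset] at h'
  refine h'.2 ?_ x.1 y.1 z.1 hxy hyz
  intro a b c hab hbc
  obtain ⟨a, b, hR, he⟩ := (mem_relCode _ _).1 hab
  obtain ⟨rfl, rfl⟩ := ZFSet.pair_inj.1 he
  obtain ⟨b', c, hS, he⟩ := (mem_relCode _ _).1 hbc
  obtain ⟨h₁, rfl⟩ := ZFSet.pair_inj.1 he
  obtain rfl := (code Y).injective h₁
  exact (pair_mem_relCode _ _ _).2 (h _ _ _ hR hS)

theorem extRel.symm {R : X → Y → Prop} {S : Y → X → Prop} (h : ∀ a b, R a b → S b a)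
    {x : N.Ext X} {y : N.Ext Y} (hxy : extRel R x y) : extRel S y x := by
  have h' := N.star.map_formula
    (∀' ∀' (pairMemF (Sum.inl 0) (up new) new ⟹ pairMemF (Sum.inl 1) new (up new)) :
        setLanguage.Formula (Fin 2))
    ![relCode R, relCode S]
  simp only [Formula.Realize, BoundedFormula.realize_all, BoundedFormula.realize_imp,
    realize_pairMemF, elim_up, elim_new, Sum.elim_inl, Function.comp_apply, Matrix.cons_val_zero,
    Matrix.cons_val_one, pairMem_zfset] at h'
  refine h'.2 ?_ x.1 y.1 hxy
  intro a b hab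
  obtain ⟨a, b, hR, he⟩ := (mem_relCode _ _).1 hab
  obtain ⟨rfl, rfl⟩ := ZFSet.pair_inj.1 he
  exact (pair_mem_relCode _ _ _).2 (h _ _ hR)

theorem extRel.mono {R S : X → Y → Prop} (h : ∀ a b, R a b → S a b)
    {x : N.Ext X} {y : N.Ext Y} (hxy : extRel R x y) : extRel S x y :=
  (hxy.symm (S := fun b a => R a b) fun _ _ => id).symm fun b a => h a b

/-- A relation which holds along the graph of a map holds along the graph of its extension. -/
theorem extRel_extMap {R : X → Y → Prop} {f : X → Y} (h : ∀ a, R a (f a)) (x : N.Ext X) :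
    extRel R x (extMap N f x) :=
  ((extRel_graph_iff f x _).2 rfl).mono fun a _ hab => hab ▸ h a

theorem extRel_refl {R : X → X → Prop} (h : ∀ a, R a a) (x : N.Ext X) : extRel R x x := by
  simpa only [extMap_id, id] using extRel_extMap (f := id) h x

theorem near_refl [UniformSpace X] (x : N.Ext X) : Near x x :=
  fun _ hU => extRel_refl (fun _ => refl_mem_uniformity hU) x

/-- The extension of a finite set has standard elements only. -/
theorem exists_pt_of_mem_extSet {F : Set X} (hF : F.Finite) {x : N.Ext X} (hx : x ∈ extSet F) :
    ∃ a ∈ F, x = N.pt a := by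
  induction F, hF using Set.Finite.induction_on with
  | empty =>
    have h := N.star.map_formula (∀' ∼(memF new (Sum.inl 0)) : setLanguage.Formula (Fin 1))
      ![setCode (∅ : Set X)]
    simp only [Formula.Realize, BoundedFormula.realize_all, BoundedFormula.realize_not,
      realize_memF, elim_new, Sum.elim_inl, Function.comp_apply, Matrix.cons_val_fin_one,
      setMem_zfset, mem_setCode] at h
    exact (h.2 (by simp) x.1 hx).elim
  | @insert a F _ _ ih =>
    have h := N.star.map_formula
      (∀' (memF new (Sum.inl 0) ⟹ (eqF new (Sum.inl 1) ⊔ memF new (Sum.inl 2))) :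
        setLanguage.Formula (Fin 3))
      ![setCode (insert a F), code X a, setCode F]
    simp only [Formula.Realize, BoundedFormula.realize_all, BoundedFormula.realize_imp,
      BoundedFormula.realize_sup, realize_memF, realize_eqF, elim_new, Sum.elim_inl,
      Function.comp_apply, Matrix.cons_val_zero, Matrix.cons_val_one, Matrix.cons_val,
      setMem_zfset, mem_setCode] at h
    rcases h.2 (by
      rintro _ ⟨b, rfl | hb, rfl⟩
      exacts [Or.inl rfl, Or.inr ⟨b, hb, rfl⟩]) x.1 hx with h | h
    · exact ⟨a, Or.inl rfl, Subtype.ext h⟩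
    · obtain ⟨b, hb, hxb⟩ := ih h
      exact ⟨b, Or.inr hb, hxb⟩

/-- The extension of a map with finite range takes standard values only. -/
theorem exists_extMap_eq_pt {f : X → Y} (hf : (Set.range f).Finite) (x : N.Ext X) :
    ∃ b ∈ Set.range f, extMap N f x = N.pt b :=
  exists_pt_of_mem_extSet hf (extMap_mem (A := Set.univ) (fun a _ => Set.mem_range_self a) x.2)

end Transfer

/-! ### Saturation -/

section Saturation

open FirstOrder.Language SetFormula

variable (N : NonstandardUniverse.{u, v})

theorem setMem_star_of_subset {a b : ZFSet.{u}} (h : a ⊆ b) {z : N.carrier}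
    (hz : SetMem z (N.star a)) : SetMem z (N.star b) := by
  have h' := N.star.map_formula
    (∀' (memF new (Sum.inl 0) ⟹ memF new (Sum.inl 1)) : setLanguage.Formula (Fin 2)) ![a, b]
  simp only [Formula.Realize, BoundedFormula.realize_all, BoundedFormula.realize_imp,
    realize_memF, elim_new, Sum.elim_inl, Function.comp_apply, Matrix.cons_val_zero,
    Matrix.cons_val_one, setMem_zfset] at h'
  exact h'.2 (fun _ hz => h hz) z hz

/-- If a set defined by a formula with internal parameters meets the extension of every member of a
downward directed family of standard sets, then it meets the intersection of these extensions. -/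
theorem exists_forall_setMem_star {k : ℕ} (ψ : setLanguage.Formula (Fin k ⊕ Unit))
    (p : Fin k → N.carrier) {S : Set ZFSet.{u}} (hne : S.Nonempty)
    (hS : DirectedOn (fun a b => b ⊆ a) S)
    (h : ∀ a ∈ S, ∃ z, SetMem z (N.star a) ∧ ψ.Realize (Sum.elim p fun _ => z)) :
    ∃ z, (∀ a ∈ S, SetMem z (N.star a)) ∧ ψ.Realize (Sum.elim p fun _ => z) := by
  let q : ZFSet.{u} ⊕ Fin k → N.carrier := Sum.elim N.star p
  -- the parameters are all standard sets and finitely many internal ones: at most `|𝕌|` in total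
  let A := Set.range q
  let ψ' : setLanguage.Formula (A ⊕ Unit) :=
    ψ.relabel (Sum.map (fun i => (⟨q (Sum.inr i), Set.mem_range_self _⟩ : A)) id)
  let χ : ZFSet.{u} → setLanguage.Formula (A ⊕ Unit) := fun a =>
    memSymbol.formula₂ (.var (Sum.inr ()))
      (.var (Sum.inl (⟨q (Sum.inl a), Set.mem_range_self _⟩ : A)))
  have hψ : ∀ z : N.carrier, ψ'.Realize (Sum.elim Subtype.val fun _ => z) ↔
      ψ.Realize (Sum.elim p fun _ => z) := fun z => by
    rw [Formula.realize_relabel]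
    refine iff_of_eq (congrArg _ ?_)
    funext i
    rcases i with i | i <;> rfl
  have hχ : ∀ a (z : N.carrier), (χ a).Realize (Sum.elim Subtype.val fun _ => z) ↔
      SetMem z (N.star a) := fun a z => by
    simp [χ, Formula.realize_rel₂, SetMem, q]
  have hA : Cardinal.lift.{u + 1} (Cardinal.mk A) <
      Cardinal.lift.{v} (Order.succ (Cardinal.mk ZFSet.{u})) := by
    have : Infinite ZFSet.{u} := Infinite.of_injective _ (code.{u} ℕ).injective
    rw [Cardinal.lift_succ, Order.lt_succ_iff]
    refine Cardinal.mk_range_le_lift.trans (Cardinal.lift_le.2 ?_)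
    rw [Cardinal.mk_sum, Cardinal.mk_fin, Cardinal.lift_id', Cardinal.lift_natCast]
    exact Cardinal.add_le_of_le (Cardinal.aleph0_le_mk _) le_rfl
      ((Cardinal.natCast_lt_aleph0).le.trans (Cardinal.aleph0_le_mk _))
  obtain ⟨z, hz⟩ := N.saturated A hA (insert ψ' (χ '' S)) (by
    intro r hr
    have : ∃ c ∈ S, ∀ z, SetMem z (N.star c) → ψ.Realize (Sum.elim p fun _ => z) →
        ∀ φ ∈ r, φ.Realize (Sum.elim Subtype.val fun _ => z) := by
      classical
      induction r using Finset.induction_on with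
      | empty => exact hne.imp fun c hc => ⟨hc, by simp⟩
      | insert φ r _ ih =>
        rw [Finset.coe_insert, Set.insert_subset_iff] at hr
        obtain ⟨c, hc, ih⟩ := ih hr.2
        rcases hr.1 with rfl | ⟨a, ha, rfl⟩
        · exact ⟨c, hc, fun z hz hψz => by simpa [hψ, hψz] using ih z hz hψz⟩
        · obtain ⟨d, hd, hdc, hda⟩ := hS c hc a ha
          refine ⟨d, hd, fun z hz hψz => ?_⟩
          simpa [hχ, setMem_star_of_subset N hda hz] using
            ih z (setMem_star_of_subset N hdc hz) hψz
    obtain ⟨c, hc, h'⟩ := this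
    obtain ⟨z, hz, hψz⟩ := h c hc
    exact ⟨z, h' z hz hψz⟩)
  exact ⟨z, fun a ha => (hχ a z).1 (hz _ (Or.inr ⟨a, ha, rfl⟩)), (hψ z).1 (hz _ (Or.inl rfl))⟩

end Saturation

end NonstandardUniverse

/-! ### Internal homotopies and S-continuity -/

/-- `((x, t), y)` belongs to `m`, in a structure for the language of set theory. -/
def TripleMem {M : Type v} [setLanguage.Structure M] (m x t y : M) : Prop :=
  ∃ q, IsPair q x t ∧ PairMem m q y

namespace SetFormula

open FirstOrder.Language

variable {α : Type} {n : ℕ} {M : Type v} [setLanguage.Structure M]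

/-- The formula defining `TripleMem`. -/
def tripleMemF (m x t y : α ⊕ Fin n) : setLanguage.BoundedFormula α n :=
  ∃' (isPairF new (up x) (up t) ⊓ pairMemF (up m) new (up y))

@[simp] theorem realize_tripleMemF (v : α → M) (xs : Fin n → M) (m x t y : α ⊕ Fin n) :
    (tripleMemF m x t y).Realize v xs ↔ TripleMem (Sum.elim v xs m) (Sum.elim v xs x)
      (Sum.elim v xs t) (Sum.elim v xs y) := by
  simp [tripleMemF, TripleMem]

end SetFormula

theorem tripleMem_zfset (m x t y : ZFSet.{u}) :
    TripleMem m x t y ↔ ZFSet.pair (ZFSet.pair x t) y ∈ m := by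
  simp [TripleMem, isPair_zfset, pairMem_zfset]

namespace NonstandardUniverse

open FirstOrder.Language SetFormula

variable {N : NonstandardUniverse.{u, v}} {X Y : Type u}

theorem exists_isPair (N : NonstandardUniverse.{u, v}) (a b : N.carrier) : ∃ z, IsPair z a b := by
  have h := N.star.map_formula
    (∀' ∀' ∃' (isPairF new (up (up new)) (up new)) : setLanguage.Formula (Fin 0)) ![]
  simp only [Formula.Realize, BoundedFormula.realize_all, BoundedFormula.realize_ex,
    realize_isPairF, elim_up, elim_new, isPair_zfset] at h
  exact h.2 (fun a b => ⟨_, rfl⟩) a b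

/-- By saturation, an S-continuous internal map is uniformly continuous at each standard scale. -/
theorem SContinuous.exists_entourage [UniformSpace X] [UniformSpace Y] {f : N.Ext X → N.Ext Y}
    (hf : SContinuous f) (hi : Internal f) {W : Set (Y × Y)} (hW : W ∈ 𝓤 Y) :
    ∃ U ∈ 𝓤 X, ∀ x x', extRel (fun a b => (a, b) ∈ U) x x' →
      extRel (fun a b => (a, b) ∈ W) (f x) (f x') := by
  by_contra! hcon
  obtain ⟨m, hm⟩ := hi
  -- `ψ(z)` says that `z` is a pair `(x, x')` with `(f x, f x') ∉ *W`; a solution of `ψ` in every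
  -- `*U` would be a pair of infinitely close points at which S-continuity fails
  let ψ : setLanguage.Formula (Fin 4 ⊕ Unit) :=
    ∃' (memF new (Sum.inl (Sum.inl 2)) ⊓ ∃' (memF new (Sum.inl (Sum.inl 2)) ⊓
      (isPairF (Sum.inl (Sum.inr ())) (up new) new ⊓ ∃' (memF new (Sum.inl (Sum.inl 3)) ⊓
        ∃' (memF new (Sum.inl (Sum.inl 3)) ⊓
          (pairMemF (Sum.inl (Sum.inl 0)) (up (up (up new))) (up new) ⊓
            (pairMemF (Sum.inl (Sum.inl 0)) (up (up new)) new ⊓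
              ∼(pairMemF (Sum.inl (Sum.inl 1)) (up new) new))))))))
  let p : Fin 4 → N.carrier := ![m, N.star (relCode fun a b => (a, b) ∈ W),
    N.star (setCode (Set.univ : Set X)), N.star (setCode (Set.univ : Set Y))]
  have hψ : ∀ z : N.carrier, ψ.Realize (Sum.elim p fun _ => z) ↔
      ∃ x x' : N.Ext X, IsPair z x.1 x'.1 ∧ ¬ extRel (fun a b => (a, b) ∈ W) (f x) (f x') := by
    intro z
    simp only [ψ, p, Formula.Realize, BoundedFormula.realize_ex, BoundedFormula.realize_inf,
      BoundedFormula.realize_not, realize_memF, realize_pairMemF, realize_isPairF, elim_up,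
      elim_new, Sum.elim_inl, Sum.elim_inr, Matrix.cons_val_zero, Matrix.cons_val_one,
      Matrix.cons_val]
    constructor
    · rintro ⟨x, hx, x', hx', hz, y, hy, y', hy', h₁, h₂, h₃⟩
      have h₁ := (hm ⟨x, hx⟩ ⟨y, hy⟩).1 h₁
      have h₂ := (hm ⟨x', hx'⟩ ⟨y', hy'⟩).1 h₂
      exact ⟨⟨x, hx⟩, ⟨x', hx'⟩, hz, by rwa [h₁, h₂]⟩
    · rintro ⟨x, x', hz, h⟩
      exact ⟨x.1, x.2, x'.1, x'.2, hz, (f x).1, (f x).2, (f x').1, (f x').2, (hm _ _).2 rfl,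
        (hm _ _).2 rfl, h⟩
  obtain ⟨z, hz, h⟩ := N.exists_forall_setMem_star ψ p
    (S := (fun U : Set (X × X) => relCode fun a b => (a, b) ∈ U) '' (𝓤 X).sets)
    ⟨_, _, Filter.univ_mem, rfl⟩ (by
      rintro _ ⟨U, hU, rfl⟩ _ ⟨U', hU', rfl⟩
      refine ⟨_, ⟨U ∩ U', Filter.inter_mem hU hU', rfl⟩, ?_, ?_⟩
      · intro z hz
        obtain ⟨a, b, h, rfl⟩ := (mem_relCode _ _).1 hz
        exact (pair_mem_relCode _ _ _).2 h.1
      · intro z hz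
        obtain ⟨a, b, h, rfl⟩ := (mem_relCode _ _).1 hz
        exact (pair_mem_relCode _ _ _).2 h.2) (by
      rintro _ ⟨U, hU, rfl⟩
      obtain ⟨x, x', ⟨z, hz, hzU⟩, h⟩ := hcon U hU
      exact ⟨z, hzU, (hψ z).2 ⟨x, x', hz, h⟩⟩)
  obtain ⟨x, x', hz', h⟩ := (hψ z).1 h
  exact h (hf x x' (fun U hU => ⟨z, hz', hz _ ⟨U, hU, rfl⟩⟩) W hW)

/-- By saturation, an S-continuous internal homotopy is uniformly continuous at each standard
scale, in both variables. -/
theorem exists_entourage_of_homotopy [UniformSpace X] [UniformSpace Y] {T : N.Ext.{u, v} ℝ}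
    {h : N.Ext X → HyperInterval T → N.Ext Y}
    (hi : ∃ m : N.carrier, ∀ x t y, TripleMem m x.1 t.1.1 y.1 ↔ h x t = y)
    (hc : ∀ x x' t t', Near x x' → Near t.1 t'.1 → Near (h x t) (h x' t'))
    {W : Set (Y × Y)} (hW : W ∈ 𝓤 Y) :
    ∃ U ∈ 𝓤 X, ∃ E ∈ 𝓤 ℝ, ∀ x x' t t', extRel (fun a b => (a, b) ∈ U) x x' →
      extRel (N := N) (fun a b : ℝ => (a, b) ∈ E) t.1 t'.1 →
      extRel (fun a b => (a, b) ∈ W) (h x t) (h x' t') := by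
  by_contra! hcon
  obtain ⟨m, hm⟩ := hi
  -- `ψ(z)` says that `z` is of the form `((x, x'), (t, t'))` with `(h(x, t), h(x', t')) ∉ *W`
  let ψ : setLanguage.Formula (Fin 8 ⊕ Unit) :=
    ∃' ∃' ((memF (up new) (Sum.inl (Sum.inl 2)) ⊓ memF new (Sum.inl (Sum.inl 2))) ⊓
      ∃' ∃' (((memF (up new) (Sum.inl (Sum.inl 4)) ⊓
          (pairMemF (Sum.inl (Sum.inl 5)) (Sum.inl (Sum.inl 6)) (up new) ⊓
            pairMemF (Sum.inl (Sum.inl 5)) (up new) (Sum.inl (Sum.inl 7)))) ⊓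
        (memF new (Sum.inl (Sum.inl 4)) ⊓
          (pairMemF (Sum.inl (Sum.inl 5)) (Sum.inl (Sum.inl 6)) new ⊓
            pairMemF (Sum.inl (Sum.inl 5)) new (Sum.inl (Sum.inl 7))))) ⊓
        (∃' ∃' (isPairF (Sum.inl (Sum.inr ())) (up new) new ⊓
            (isPairF (up new) (up (up (up (up (up new))))) (up (up (up (up new)))) ⊓
              isPairF new (up (up (up new))) (up (up new)))) ⊓
          ∃' ∃' ((memF (up new) (Sum.inl (Sum.inl 3)) ⊓ memF new (Sum.inl (Sum.inl 3))) ⊓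
            (tripleMemF (Sum.inl (Sum.inl 0)) (up (up (up (up (up new))))) (up (up (up new)))
                (up new) ⊓
              (tripleMemF (Sum.inl (Sum.inl 0)) (up (up (up (up new)))) (up (up new)) new ⊓
                ∼(pairMemF (Sum.inl (Sum.inl 1)) (up new) new)))))))
  let p : Fin 8 → N.carrier := ![m, N.star (relCode fun a b => (a, b) ∈ W),
    N.star (setCode (Set.univ : Set X)), N.star (setCode (Set.univ : Set Y)),
    N.star (setCode (Set.univ : Set ℝ)), N.star (relCode ((· ≤ ·) : ℝ → ℝ → Prop)),
    (N.pt (0 : ℝ)).1, T.1]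
  have hψ : ∀ z : N.carrier, ψ.Realize (Sum.elim p fun _ => z) ↔
      ∃ (x x' : N.Ext X) (t t' : HyperInterval T),
        (∃ a b, IsPair z a b ∧ IsPair a x.1 x'.1 ∧ IsPair b t.1.1 t'.1.1) ∧
          ¬ extRel (fun a b => (a, b) ∈ W) (h x t) (h x' t') := by
    intro z
    simp only [ψ, p, Formula.Realize, BoundedFormula.realize_ex, BoundedFormula.realize_inf,
      BoundedFormula.realize_not, realize_memF, realize_pairMemF, realize_isPairF,
      realize_tripleMemF, elim_up, elim_new, Sum.elim_inl, Sum.elim_inr, Matrix.cons_val_zero,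
      Matrix.cons_val_one, Matrix.cons_val]
    constructor
    · rintro ⟨x, x', ⟨hx, hx'⟩, t, t', ⟨⟨ht, h0, hT⟩, ht', h0', hT'⟩, hz, y, y', ⟨hy, hy'⟩, h₁, h₂,
        h₃⟩
      have h₁ := (hm ⟨x, hx⟩ ⟨⟨t, ht⟩, h0, hT⟩ ⟨y, hy⟩).1 h₁
      have h₂ := (hm ⟨x', hx'⟩ ⟨⟨t', ht'⟩, h0', hT'⟩ ⟨y', hy'⟩).1 h₂
      exact ⟨⟨x, hx⟩, ⟨x', hx'⟩, ⟨⟨t, ht⟩, h0, hT⟩, ⟨⟨t', ht'⟩, h0', hT'⟩, hz, by rwa [h₁, h₂]⟩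
    · rintro ⟨x, x', t, t', hz, h'⟩
      exact ⟨x.1, x'.1, ⟨x.2, x'.2⟩, t.1.1, t'.1.1, ⟨⟨t.1.2, t.2⟩, t'.1.2, t'.2⟩, hz,
        (h x t).1, (h x' t').1, ⟨(h x t).2, (h x' t').2⟩, (hm _ _ _).2 rfl, (hm _ _ _).2 rfl, h'⟩
  have hprod : ∀ (c d : ZFSet.{u}) (z a b : N.carrier), IsPair z a b →
      (SetMem z (N.star (ZFSet.prod c d)) ↔ SetMem a (N.star c) ∧ SetMem b (N.star d)) := by
    intro c d
    have h' := N.star.map_formula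
      (∀' ∀' ∀' (isPairF (up (up new)) (up new) new ⟹ (memF (up (up new)) (Sum.inl 0) ⇔
        (memF (up new) (Sum.inl 1) ⊓ memF new (Sum.inl 2)))) : setLanguage.Formula (Fin 3))
      ![ZFSet.prod c d, c, d]
    simp only [Formula.Realize, BoundedFormula.realize_all, BoundedFormula.realize_imp,
      BoundedFormula.realize_iff, BoundedFormula.realize_inf, realize_isPairF,
      realize_memF, elim_up, elim_new, Sum.elim_inl, Function.comp_apply, Matrix.cons_val_zero,
      Matrix.cons_val_one, Matrix.cons_val, setMem_zfset, isPair_zfset] at h'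
    refine h'.2 ?_
    rintro _ a b rfl
    exact ZFSet.pair_mem_prod
  obtain ⟨z, hz, h'⟩ := N.exists_forall_setMem_star ψ p
    (S := {c | ∃ U ∈ 𝓤 X, ∃ E ∈ 𝓤 ℝ, c = ZFSet.prod (relCode fun a b => (a, b) ∈ U)
      (relCode fun a b => (a, b) ∈ E)})
    ⟨_, _, Filter.univ_mem, _, Filter.univ_mem, rfl⟩ (by
      rintro _ ⟨U, hU, E, hE, rfl⟩ _ ⟨U', hU', E', hE', rfl⟩
      refine ⟨_, ⟨U ∩ U', Filter.inter_mem hU hU', E ∩ E', Filter.inter_mem hE hE', rfl⟩, ?_, ?_⟩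
      · intro z hz
        obtain ⟨c, hc, d, hd, rfl⟩ := ZFSet.mem_prod.1 hz
        obtain ⟨a, b, h, rfl⟩ := (mem_relCode _ _).1 hc
        obtain ⟨a', b', h', rfl⟩ := (mem_relCode _ _).1 hd
        exact ZFSet.pair_mem_prod.2
          ⟨(pair_mem_relCode _ _ _).2 h.1, (pair_mem_relCode _ _ _).2 h'.1⟩
      · intro z hz
        obtain ⟨c, hc, d, hd, rfl⟩ := ZFSet.mem_prod.1 hz
        obtain ⟨a, b, h, rfl⟩ := (mem_relCode _ _).1 hc
        obtain ⟨a', b', h', rfl⟩ := (mem_relCode _ _).1 hd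
        exact ZFSet.pair_mem_prod.2
          ⟨(pair_mem_relCode _ _ _).2 h.2, (pair_mem_relCode _ _ _).2 h'.2⟩) (by
      rintro _ ⟨U, hU, E, hE, rfl⟩
      obtain ⟨x, x', t, t', ⟨a, ha, haU⟩, ⟨b, hb, hbE⟩, h⟩ := hcon U hU E hE
      obtain ⟨z, hz⟩ := N.exists_isPair a b
      exact ⟨z, (hprod _ _ _ _ _ hz).2 ⟨haU, hbE⟩, (hψ z).2 ⟨x, x', t, t', ⟨a, b, hz, ha, hb⟩, h⟩⟩)
  obtain ⟨x, x', t, t', ⟨a, b, hzab, ha, hb⟩, h'⟩ := (hψ z).1 h'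
  refine h' (hc x x' t t' (fun U hU => ⟨a, ha, ?_⟩) (fun E hE => ⟨b, hb, ?_⟩) W hW)
  · exact ((hprod _ _ _ _ _ hzab).1 (hz _ ⟨U, hU, _, Filter.univ_mem, rfl⟩)).1
  · exact ((hprod _ _ _ _ _ hzab).1 (hz _ ⟨_, Filter.univ_mem, E, hE, rfl⟩)).2

end NonstandardUniverse

open NonstandardUniverse

/-! ### Preshadows -/

theorem exists_symm_half {X : Type u} [UniformSpace X] {W : Set (X × X)} (hW : W ∈ 𝓤 X) :
    ∃ V ∈ 𝓤 X, (∀ a b, (a, b) ∈ V → (b, a) ∈ V) ∧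
      ∀ a b c, (a, b) ∈ V → (b, c) ∈ V → (a, c) ∈ W := by
  obtain ⟨V, hV, hs, hVW⟩ := comp_symm_mem_uniformity_sets hW
  exact ⟨V, hV, fun a b h => hs.symm _ _ h, fun a b c h₁ h₂ => hVW ⟨b, h₁, h₂⟩⟩

/-- A precompact uniform pair has retractions of finite range, close to the identity, onto finite
nets adapted to the subset. -/
theorem IsPrecompactPair.exists_finite_range {P : UPair.{u}} (hP : IsPrecompactPair P)
    {U : Set (P.carrier × P.carrier)} (hU : U ∈ 𝓤 P.carrier) :
    ∃ p : P.carrier → P.carrier, (Set.range p).Finite ∧ (∀ x, (p x, x) ∈ U) ∧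
      Set.MapsTo p P.sub P.sub := by
  have hU' := UniformSpace.symm hU
  obtain ⟨F, -, hF, hFU⟩ := totallyBounded_iff_subset.1 hP _ hU'
  obtain ⟨E, hEA, hE, hEU⟩ :=
    totallyBounded_iff_subset.1 (TotallyBounded.subset (Set.subset_univ P.sub) hP) _ hU'
  have h : ∀ x, ∃ y ∈ F ∪ E, (y, x) ∈ U ∧ (x ∈ P.sub → y ∈ P.sub) := by
    intro x
    by_cases hx : x ∈ P.sub
    · obtain ⟨y, hy, hyx⟩ := Set.mem_iUnion₂.1 (hEU hx)
      exact ⟨y, Or.inr hy, hyx, fun _ => hEA hy⟩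
    · obtain ⟨y, hy, hyx⟩ := Set.mem_iUnion₂.1 (hFU (Set.mem_univ x))
      exact ⟨y, Or.inl hy, hyx, fun h => (hx h).elim⟩
  choose p hp hpU hpA using h
  exact ⟨p, (hF.union hE).subset (Set.range_subset_iff.2 hp), hpU, fun x hx => hpA x hx⟩

variable {N : NonstandardUniverse.{u, v}}

/-- The S-continuous maps which obey a given standard modulus of continuity have `W`-preshadows in
a common finite set of maps: with finite nets `p` of `X` and `q` of `Y`, the map `q ∘ f ∘ p` takes
standard values at standard points and is determined by finitely many of them. -/
theorem exists_finite_preshadows {P Q : UPairS N} (hP : IsPrecompactPair P.as)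
    (hQ : IsPrecompactPair Q.as) {W : Set (Q.as.carrier × Q.as.carrier)}
    (hW : W ∈ 𝓤 Q.as.carrier) :
    ∃ W' ∈ 𝓤 Q.as.carrier, ∀ U ∈ 𝓤 P.as.carrier,
      ∃ K : Set (P.as.carrier → Q.as.carrier), K.Finite ∧ ∀ f : P ⟶ Q,
        (∀ x x', extRel (fun a b => (a, b) ∈ U) x x' →
          extRel (fun a b => (a, b) ∈ W') (f.toFun x) (f.toFun x')) →
        ∃ k ∈ K, IsPreshadow f W k := by
  obtain ⟨W₁, hW₁, hs₁, hW₁W⟩ := exists_symm_half hW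
  obtain ⟨W₂, hW₂, hs₂, hW₂W⟩ := exists_symm_half hW₁
  obtain ⟨W₃, hW₃, hs₃, hW₃W⟩ := exists_symm_half hW₂
  -- `(k x, k y) ∈ W` is obtained in five `W₃`-steps, through `f` at `p x`, `x`, `y` and `p y`
  refine ⟨W₃, hW₃, fun U hU => ?_⟩
  obtain ⟨p, hp, hpU, hpA⟩ := hP.exists_finite_range hU
  obtain ⟨q, hq, hqW, hqB⟩ := hQ.exists_finite_range hW₃
  have := hp.to_subtype
  have := hq.to_subtype
  refine ⟨Set.range fun (κ : Set.range p → Set.range q) x => (κ ⟨p x, x, rfl⟩ : Q.as.carrier),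
    Set.finite_range _, fun f hf => ?_⟩
  have hval : ∀ x₀ : Set.range p, ∃ y₀ : Set.range q,
      extMap N q (f.toFun (N.pt x₀.1)) = N.pt y₀.1 := fun x₀ =>
    let ⟨y, hy, h⟩ := exists_extMap_eq_pt hq (f.toFun (N.pt x₀.1))
    ⟨⟨y, hy⟩, h⟩
  choose κ hκ using hval
  let k : P.as.carrier → Q.as.carrier := fun x => κ ⟨p x, x, rfl⟩
  have hqW' : ∀ y, extRel (fun a b => (a, b) ∈ W₃) (extMap N q y) y := fun y =>
    (extRel_extMap (R := fun a b => (b, a) ∈ W₃) hqW y).symm fun _ _ => id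
  have hpU' : ∀ x, extRel (fun a b => (a, b) ∈ U) (extMap N p x) x := fun x =>
    (extRel_extMap (R := fun a b => (b, a) ∈ U) hpU x).symm fun _ _ => id
  have hk : ∀ x, extMap N k x = extMap N q (f.toFun (extMap N p x)) := by
    intro x
    obtain ⟨_, ⟨x₀, rfl⟩, hx⟩ := exists_extMap_eq_pt hp x
    -- `k` factors through `p`, so its value at `x` is that of `κ` at the standard point `*p(x)`
    classical
    let κ' : P.as.carrier → Q.as.carrier := fun a =>
      if h : a ∈ Set.range p then κ ⟨a, h⟩ else q (k a)
    have hκ' : k = κ' ∘ p := funext fun a => by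
      simp only [κ', Function.comp_apply]
      rw [dif_pos (Set.mem_range_self a)]
    rw [hκ', extMap_comp, Function.comp_apply, hx, extMap_pt, hκ ⟨p x₀, x₀, rfl⟩]
    exact congrArg _ (dif_pos (c := p x₀ ∈ Set.range p) (Set.mem_range_self x₀))
  have hclose : ∀ x, extRel (fun a b => (a, b) ∈ W₂) (extMap N k x) (f.toFun x) := fun x => by
    rw [hk]
    exact (hqW' _).trans hW₃W (hf _ _ (hpU' x))
  refine ⟨k, ⟨κ, rfl⟩, fun x hx => ?_, ⟨U, hU, fun x y hxy => ?_⟩, fun x => ?_⟩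
  · have h := extMap_mem (N := N) hqB (f.mapsTo (pt_mem_extSet.2 (hpA hx)))
    rw [hκ ⟨p x, x, rfl⟩] at h
    exact pt_mem_extSet.1 h
  · refine (extRel_pt (N := N) (R := fun a b => (a, b) ∈ W)).1 ?_
    rw [← extMap_pt, ← extMap_pt]
    have h₁ := (hclose (N.pt x)).trans hW₂W
      (((hf _ _ (extRel_pt.2 hxy)).mono fun a b h => hW₃W _ _ _ h (refl_mem_uniformity hW₃)))
    exact h₁.trans hW₁W (((hclose (N.pt y)).symm hs₂).mono fun a b h =>
      hW₂W _ _ _ h (refl_mem_uniformity hW₂))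
  · exact (hclose x).mono fun a b h =>
      hW₁W _ _ _ (hW₂W _ _ _ h (refl_mem_uniformity hW₂)) (refl_mem_uniformity hW₁)

theorem exists_preshadow {P Q : UPairS N} (hP : IsPrecompactPair P.as)
    (hQ : IsPrecompactPair Q.as) (f : P ⟶ Q) {W : Set (Q.as.carrier × Q.as.carrier)}
    (hW : W ∈ 𝓤 Q.as.carrier) : ∃ k, IsPreshadow f W k := by
  obtain ⟨W', hW', h⟩ := exists_finite_preshadows hP hQ hW
  obtain ⟨U, hU, hf⟩ := f.sContinuous.exists_entourage f.internal hW'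
  obtain ⟨K, -, hK⟩ := h U hU
  exact (hK f hf).imp fun _ h => h.2

/-! ### The induced homomorphism -/

noncomputable section

/-- The cover of `X` by the sets `U[x]`, as a uniform cover. -/
def UCov.ofEntourage {X : Type u} [UniformSpace X] {U : Set (X × X)} (hU : U ∈ 𝓤 X) : UCov X :=
  ⟨ballCover U, U, hU, fun S hS => ⟨S, hS, subset_rfl⟩⟩

/-- The data from which the component at `𝒱` of the homomorphism induced by `f` is computed: a
preshadow of `f` which is fine enough for `𝒱`, and a uniform cover on which it is simplicial. -/
structure PreshadowAt {P Q : UPairS N} (f : P ⟶ Q) (𝒱 : UCov Q.as.carrier) where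
  V : Set (Q.as.carrier × Q.as.carrier)
  W : Set (Q.as.carrier × Q.as.carrier)
  refines : Refines (ballCover V) 𝒱.1
  W_mem : W ∈ 𝓤 Q.as.carrier
  comp_W : ∀ x y z, (x, y) ∈ W → (y, z) ∈ W → (x, z) ∈ V
  k : P.as.carrier → Q.as.carrier
  isPreshadow : IsPreshadow f W k
  𝒰 : UCov P.as.carrier
  simplicial : IsSimplicialPairMap P.as Q.as 𝒰.1 𝒱.1 k

namespace PreshadowAt

variable {P Q : UPairS N} {f : P ⟶ Q} {𝒱 : UCov Q.as.carrier}

/-- The homomorphism `H_n(k) ∘ π_𝒰` from the uniform Vietoris homology of `X` to the homology at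
`𝒱`. -/
def hom (G : Type u) [AddCommGroup G] (n : ℕ) (d : PreshadowAt f 𝒱) :
    uvHomology G n P.as ⟶ (relativeHomology G n).obj (vietorisPair Q.as 𝒱.1) :=
  uvProj G n P.as d.𝒰 ≫ (relativeHomology G n).map (vietorisPairMap d.k d.simplicial)

theorem exists_of_isPreshadow {W : Set (Q.as.carrier × Q.as.carrier)}
    (hW : W ∈ 𝓤 Q.as.carrier) {V : Set (Q.as.carrier × Q.as.carrier)}
    (hV : Refines (ballCover V) 𝒱.1)
    (hWV : ∀ x y z, (x, y) ∈ W → (y, z) ∈ W → (x, z) ∈ V) {k : P.as.carrier → Q.as.carrier}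
    (hk : IsPreshadow f W k) : ∃ d : PreshadowAt f 𝒱, d.k = k ∧ d.W = W := by
  obtain ⟨U, hU, hkU⟩ := hk.uniformlyContinuous
  refine ⟨⟨V, W, hV, hW, hWV, k, hk, .ofEntourage hU, hk.mapsTo, ?_⟩, rfl, rfl⟩
  rintro p a ⟨_, ⟨x, rfl⟩, ha⟩
  obtain ⟨T, hT, hVT⟩ := hV _ ⟨k x, rfl⟩
  exact ⟨T, hT, fun i => hVT (hWV _ _ _ (refl_mem_uniformity hW) (hkU _ _ (ha i)))⟩

/-- A preshadow may be replaced by a much finer one: near a point `x`, the values of both maps lie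
in `V[k(x)]`, so that they are contiguous on a fine enough cover. -/
theorem hom_eq_of_fine (G : Type u) [AddCommGroup G] (n : ℕ) (d e : PreshadowAt f 𝒱)
    (hs : ∀ a b, (a, b) ∈ e.W → (b, a) ∈ e.W)
    (h : ∀ a b c, (a, b) ∈ e.W → (b, c) ∈ e.W → (a, c) ∈ d.W) : d.hom G n = e.hom G n := by
  obtain ⟨U₁, hU₁, hkU⟩ := d.isPreshadow.uniformlyContinuous
  obtain ⟨U₂, hU₂, hfU⟩ := f.sContinuous.exists_entourage f.internal e.W_mem
  obtain ⟨U₃, hU₃, hd⟩ := d.𝒰.2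
  obtain ⟨U₄, hU₄, he⟩ := e.𝒰.2
  have hU := Filter.inter_mem (Filter.inter_mem hU₁ hU₂) (Filter.inter_mem hU₃ hU₄)
  have hled : d.𝒰 ≤ UCov.ofEntourage hU := by
    rintro _ ⟨x, rfl⟩
    obtain ⟨T, hT, hxT⟩ := hd _ ⟨x, rfl⟩
    exact ⟨T, hT, fun y hy => hxT hy.2.1⟩
  have hlee : e.𝒰 ≤ UCov.ofEntourage hU := by
    rintro _ ⟨x, rfl⟩
    obtain ⟨T, hT, hxT⟩ := he _ ⟨x, rfl⟩
    exact ⟨T, hT, fun y hy => hxT hy.2.2⟩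
  have hd' := d.simplicial.comp (isSimplicialPairMap_id P.as hled)
  have he' := e.simplicial.comp (isSimplicialPairMap_id P.as hlee)
  refine (uvProj_comp_map G n hled d.simplicial hd').symm.trans (Eq.trans ?_
    (uvProj_comp_map G n hlee e.simplicial he'))
  refine congrArg _ (relativeHomology_map_eq_of_contiguous G n hd' he' ?_)
  rintro _ ⟨x, rfl⟩
  obtain ⟨T, hT, hVT⟩ := d.refines _ ⟨d.k x, rfl⟩
  refine ⟨T, hT, fun y hy => ⟨hVT ?_, hVT ?_⟩⟩
  · exact d.comp_W _ _ _ (refl_mem_uniformity d.W_mem) (hkU _ _ hy.1.1)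
  · refine (extRel_pt (N := N) (R := fun a b => (a, b) ∈ d.V)).1 ?_
    rw [← extMap_pt, ← extMap_pt]
    exact (d.isPreshadow.close _).trans d.comp_W ((hfU _ _ (extRel_pt.2 hy.1.2)).trans h
      ((e.isPreshadow.close _).symm hs))

theorem hom_eq_hom (hP : IsPrecompactPair P.as) (hQ : IsPrecompactPair Q.as) (G : Type u)
    [AddCommGroup G] (n : ℕ) (d d' : PreshadowAt f 𝒱) : d.hom G n = d'.hom G n := by
  obtain ⟨W, hW, hs, hWd⟩ := exists_symm_half (Filter.inter_mem d.W_mem d'.W_mem)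
  obtain ⟨k, hk⟩ := exists_preshadow hP hQ f hW
  have hWd' : ∀ x y, (x, y) ∈ W → (x, y) ∈ d.W := fun x y h =>
    (hWd _ _ _ h (refl_mem_uniformity hW)).1
  obtain ⟨e, -, rfl⟩ := exists_of_isPreshadow (f := f) hW d.refines
    (fun x y z h₁ h₂ => d.comp_W _ _ _ (hWd' _ _ h₁) (hWd' _ _ h₂)) hk
  exact (hom_eq_of_fine G n d e hs fun a b c h₁ h₂ => (hWd a b c h₁ h₂).1).trans
    (hom_eq_of_fine G n d' e hs fun a b c h₁ h₂ => (hWd a b c h₁ h₂).2).symm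

theorem nonempty (hP : IsPrecompactPair P.as) (hQ : IsPrecompactPair Q.as) (f : P ⟶ Q)
    (𝒱 : UCov Q.as.carrier) : Nonempty (PreshadowAt f 𝒱) := by
  obtain ⟨V, hV, hV𝒱⟩ := 𝒱.2
  obtain ⟨W, hW, -, hWV⟩ := exists_symm_half hV
  obtain ⟨k, hk⟩ := exists_preshadow hP hQ f hW
  exact (exists_of_isPreshadow hW hV𝒱 hWV hk).nonempty

end PreshadowAt

theorem isInducedBy_iff (G : Type u) [AddCommGroup G] (n : ℕ) {P Q : UPairS N} (f : P ⟶ Q)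
    (φ : uvHomology G n P.as ⟶ uvHomology G n Q.as) :
    IsInducedBy G n f φ ↔
      ∀ (𝒱 : UCov Q.as.carrier) (d : PreshadowAt f 𝒱), φ ≫ uvProj G n Q.as 𝒱 = d.hom G n := by
  refine ⟨fun h 𝒱 d => h 𝒱 d.V d.W ?_ d.refines d.W_mem d.comp_W d.k d.isPreshadow d.𝒰
    d.simplicial, fun h 𝒱 V W _ hV hW hWV k hk 𝒰 hk' => h 𝒱 ⟨V, W, hV, hW, hWV, k, hk, 𝒰, hk'⟩⟩
  exact Filter.mem_of_superset d.W_mem fun x hx =>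
    d.comp_W _ _ _ (refl_mem_uniformity d.W_mem) hx

variable {P Q R : UPairS N} (hP : IsPrecompactPair P.as) (hQ : IsPrecompactPair Q.as)
  (hR : IsPrecompactPair R.as) (G : Type u) [AddCommGroup G] (n : ℕ)

/-- The homomorphism of uniform Vietoris homology induced by an S-continuous map. -/
def inducedMap (f : P ⟶ Q) : uvHomology G n P.as ⟶ uvHomology G n Q.as :=
  limit.lift (vietorisSystem G n Q.as)
    { pt := uvHomology G n P.as
      π :=
        { app := fun 𝒱 => (PreshadowAt.nonempty hP hQ f 𝒱.unop).some.hom G n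
          naturality := by
            intro 𝒱 𝒱' h
            let d := (PreshadowAt.nonempty hP hQ f 𝒱.unop).some
            have hle : 𝒱'.unop ≤ 𝒱.unop := h.unop.le
            -- a preshadow which is fine enough for a cover is fine enough for coarser ones
            let d' : PreshadowAt f 𝒱'.unop :=
              { d with
                refines := fun S hS =>
                  let ⟨T, hT, hST⟩ := d.refines S hS
                  (hle T hT).imp fun _ hT' => ⟨hT'.1, hST.trans hT'.2⟩
                simplicial := (isSimplicialPairMap_id Q.as hle).comp d.simplicial }
            refine (Category.id_comp _).trans ((PreshadowAt.hom_eq_hom hP hQ G n _ d').trans ?_)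
            exact (congrArg _ ((relativeHomology G n).map_comp (vietorisPairMap d.k d.simplicial)
              (vietorisPairMap id (isSimplicialPairMap_id Q.as hle)))).trans
              (Category.assoc _ _ _).symm } }

theorem inducedMap_proj (f : P ⟶ Q) {𝒱 : UCov Q.as.carrier} (d : PreshadowAt f 𝒱) :
    inducedMap hP hQ G n f ≫ uvProj G n Q.as 𝒱 = d.hom G n :=
  (limit.lift_π _ _).trans (PreshadowAt.hom_eq_hom hP hQ G n _ d)

theorem isInducedBy_iff_eq_inducedMap (f : P ⟶ Q)
    (φ : uvHomology G n P.as ⟶ uvHomology G n Q.as) :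
    IsInducedBy G n f φ ↔ φ = inducedMap hP hQ G n f := by
  rw [isInducedBy_iff]
  refine ⟨fun h => limit.hom_ext fun 𝒱 => ?_, ?_⟩
  · obtain ⟨d⟩ := PreshadowAt.nonempty hP hQ f 𝒱.unop
    exact (h 𝒱.unop d).trans (inducedMap_proj hP hQ G n f d).symm
  · rintro rfl 𝒱 d
    exact inducedMap_proj hP hQ G n f d

/-- A uniformly continuous map is a preshadow of its own extension, at every scale. -/
theorem inducedMap_star {P Q : UPair.{u}} (hP : IsPrecompactPair P) (hQ : IsPrecompactPair Q)
    (f : P ⟶ Q) :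
    inducedMap (P := (starFunctor N).obj P) (Q := (starFunctor N).obj Q) hP hQ G n
      ((starFunctor N).map f) = uvMap G n f := by
  refine limit.hom_ext fun 𝒱 => ?_
  obtain ⟨V, hV, hV𝒱⟩ := 𝒱.unop.2
  obtain ⟨W, hW, -, hWV⟩ := exists_symm_half hV
  let d : PreshadowAt ((starFunctor N).map f) 𝒱.unop :=
    ⟨V, W, hV𝒱, hW, hWV, f.toFun, ⟨f.mapsTo, ⟨_, f.uniformContinuous hW, fun _ _ h => h⟩,
      fun x => extRel_refl (fun _ => refl_mem_uniformity hW) _⟩, 𝒱.unop.preimage f,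
      isSimplicialPairMap_preimage f 𝒱.unop⟩
  exact (inducedMap_proj (P := (starFunctor N).obj P) (Q := (starFunctor N).obj Q) hP hQ G n _
    d).trans (uvMap_proj G n f 𝒱.unop).symm

/-- Functoriality holds because `l ∘ k` is a preshadow of `g ∘ f` if `l` is a preshadow of `g` and
`k` is a preshadow of `f` which is fine compared with the modulus of continuity of `l`. -/
theorem inducedMap_comp (f : P ⟶ Q) (g : Q ⟶ R) :
    inducedMap hP hR G n (f ≫ g) = inducedMap hP hQ G n f ≫ inducedMap hQ hR G n g := by
  refine limit.hom_ext fun 𝒱 => ?_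
  obtain ⟨V, hV, hV𝒱⟩ := 𝒱.unop.2
  obtain ⟨W, hW, -, hWV⟩ := exists_symm_half hV
  obtain ⟨W₁, hW₁, -, hW₁W⟩ := exists_symm_half hW
  have hW₁W' : ∀ a b, (a, b) ∈ W₁ → (a, b) ∈ W := fun a b h =>
    hW₁W _ _ _ h (refl_mem_uniformity hW₁)
  obtain ⟨l, hl⟩ := exists_preshadow hQ hR g hW₁
  obtain ⟨d, rfl, -⟩ := PreshadowAt.exists_of_isPreshadow (f := g) (𝒱 := 𝒱.unop) hW₁ hV𝒱
    (fun x y z h₁ h₂ => hWV _ _ _ (hW₁W' _ _ h₁) (hW₁W' _ _ h₂)) hl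
  obtain ⟨U, hU, hlU⟩ := hl.uniformlyContinuous
  obtain ⟨V', hV', hV'𝒰⟩ := d.𝒰.2
  obtain ⟨U', hU', -, hU'U⟩ := exists_symm_half (Filter.inter_mem hU hV')
  obtain ⟨k, hk⟩ := exists_preshadow hP hQ f hU'
  obtain ⟨e, rfl, -⟩ := PreshadowAt.exists_of_isPreshadow (f := f) (𝒱 := d.𝒰) hU' hV'𝒰
    (fun x y z h₁ h₂ => (hU'U _ _ _ h₁ h₂).2) hk
  have hU'U' : ∀ a b, (a, b) ∈ U' → (a, b) ∈ U := fun a b h =>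
    (hU'U _ _ _ h (refl_mem_uniformity hU')).1
  have hdk : IsPreshadow (f ≫ g) W (d.k ∘ e.k) :=
    { mapsTo := hl.mapsTo.comp hk.mapsTo
      uniformlyContinuous :=
        let ⟨U₀, hU₀, h⟩ := hk.uniformlyContinuous
        ⟨U₀, hU₀, fun x y hxy => hW₁W' _ _ (hlU _ _ (hU'U' _ _ (h x y hxy)))⟩
      close := fun x => by
        rw [extMap_comp]
        exact (extMap_rel (R := fun a b => (a, b) ∈ U') (fun a b h => hlU _ _ (hU'U' _ _ h)) _ _
          (hk.close x)).trans hW₁W (hl.close (f.toFun x)) }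
  have h₁ := inducedMap_proj hP hR G n (f ≫ g)
    ⟨V, W, hV𝒱, hW, hWV, d.k ∘ e.k, hdk, e.𝒰, d.simplicial.comp e.simplicial⟩
  have h₂ := inducedMap_proj hP hQ G n f e
  have h₃ := inducedMap_proj hQ hR G n g d
  rw [PreshadowAt.hom] at h₁ h₂ h₃
  have h₄ := (relativeHomology G n).map_comp (vietorisPairMap e.k e.simplicial)
    (vietorisPairMap d.k d.simplicial)
  rw [vietorisPairMap_comp] at h₄
  have h₅ : inducedMap hP hR G n (f ≫ g) ≫ uvProj G n R.as 𝒱.unop =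
      (inducedMap hP hQ G n f ≫ inducedMap hQ hR G n g) ≫ uvProj G n R.as 𝒱.unop := by
    rw [h₁, h₄, Category.assoc, h₃, ← Category.assoc, ← h₂, Category.assoc]
  exact h₅

/-- Uniform Vietoris homology as a functor on uniform pairs and S-continuous
maps. -/
def sHomology (N : NonstandardUniverse.{u, v}) : PUPairS N ⥤ AddCommGrpCat.{u} where
  obj P := uvHomology G n P.obj.as
  map {P Q} f := inducedMap P.property Q.property G n f.hom
  map_id P := by
    have h := inducedMap_star (N := N) G n P.property P.property (𝟙 P.obj.as)
    rw [(starFunctor N).map_id] at h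
    exact h.trans ((uniformVietorisHomology G n).map_id P.obj.as)
  map_comp {P Q R} f g := inducedMap_comp P.property Q.property R.property G n f.hom g.hom

/-- The functor on S-continuous maps extends uniform Vietoris homology. -/
def pStarFunctorCompSHomologyIso (N : NonstandardUniverse.{u, v}) :
    pStarFunctor N ⋙ sHomology G n N ≅ IsPrecompactPair.{u}.ι ⋙ uniformVietorisHomology G n :=
  NatIso.ofComponents (fun P => Iso.refl (uvHomology G n P.obj)) fun {P Q} f =>
    (Category.comp_id _).trans
      ((inducedMap_star (N := N) G n P.property Q.property f.hom).trans (Category.id_comp _).symm)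

/-- S-continuous maps with a common preshadow which is fine enough for the cover `𝒱` induce
homomorphisms with the same component at `𝒱`. -/
theorem inducedMap_proj_eq_of_isPreshadow {f g : P ⟶ Q} {𝒱 : UCov Q.as.carrier}
    {V W : Set (Q.as.carrier × Q.as.carrier)} (hV : Refines (ballCover V) 𝒱.1)
    (hW : W ∈ 𝓤 Q.as.carrier) (hWV : ∀ x y z, (x, y) ∈ W → (y, z) ∈ W → (x, z) ∈ V)
    {k : P.as.carrier → Q.as.carrier} (hf : IsPreshadow f W k) (hg : IsPreshadow g W k) :
    inducedMap hP hQ G n f ≫ uvProj G n Q.as 𝒱 = inducedMap hP hQ G n g ≫ uvProj G n Q.as 𝒱 := by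
  obtain ⟨d, hd, -⟩ := PreshadowAt.exists_of_isPreshadow hW hV hWV hf
  subst hd
  rw [inducedMap_proj hP hQ G n f d]
  exact (inducedMap_proj hP hQ G n g
    ⟨V, W, hV, hW, hWV, d.k, hg, d.𝒰, d.simplicial⟩).symm

end

namespace NonstandardUniverse

/-! ### Internal sets of hyperreals -/

open FirstOrder.Language SetFormula

variable {N : NonstandardUniverse.{u, v}} {X Y : Type u}

/-- A subset of `*X` is internal if it consists of the points which belong to an element of `*𝕌`. -/
def IsInternalSet {X : Type w} [Small.{u} X] (D : Set (N.Ext X)) : Prop :=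
  ∃ d : N.carrier, ∀ x, x ∈ D ↔ SetMem x.1 d

theorem isInternalSet_biUnion {X : Type w} [Small.{u} X] {ι : Type*} {K : Set ι} (hK : K.Finite)
    {D : ι → Set (N.Ext X)} (hD : ∀ k, IsInternalSet (D k)) : IsInternalSet (⋃ k ∈ K, D k) := by
  induction K, hK using Set.Finite.induction_on with
  | empty =>
    have h := N.star.map_formula (∃' ∀' ∼(memF new (up new)) : setLanguage.Formula (Fin 0)) ![]
    simp only [Formula.Realize, BoundedFormula.realize_all, BoundedFormula.realize_ex,
      BoundedFormula.realize_not, realize_memF, elim_up, elim_new, setMem_zfset] at h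
    obtain ⟨d, hd⟩ := h.2 ⟨∅, ZFSet.notMem_empty⟩
    exact ⟨d, fun x => by simp [hd]⟩
  | @insert k K _ _ ih =>
    obtain ⟨d, hd⟩ := ih
    obtain ⟨e, he⟩ := hD k
    have h := N.star.map_formula (∀' ∀' ∃' ∀' (memF new (up new) ⇔
      (memF new (up (up (up new))) ⊔ memF new (up (up new)))) : setLanguage.Formula (Fin 0)) ![]
    simp only [Formula.Realize, BoundedFormula.realize_all, BoundedFormula.realize_ex,
      BoundedFormula.realize_iff, BoundedFormula.realize_sup, realize_memF, elim_up, elim_new,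
      setMem_zfset] at h
    obtain ⟨c, hc⟩ := h.2 (fun a b => ⟨a ∪ b, fun _ => ZFSet.mem_union⟩) e d
    exact ⟨c, fun x => by rw [Set.biUnion_insert, hc, ← he, ← hd]; rfl⟩

/-- The Archimedean property, transferred to internal sets: an internal set of hyperreals which
contains `0` and is closed under increments of size at most a standard `δ > 0` below `T` contains
`T`, even if `T` is infinite. -/
theorem IsInternalSet.archimedean_induction {D : Set (N.Ext ℝ)} (hD : IsInternalSet D) {δ : ℝ}
    (hδ : 0 < δ) {T : N.Ext ℝ} (hT : extRel (· ≤ ·) (N.pt 0) T) (h0 : N.pt 0 ∈ D)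
    (hstep : ∀ s t, s ∈ D → extRel (fun s t => s ≤ t ∧ t - s ≤ δ) s t → extRel (· ≤ ·) t T →
      t ∈ D) : T ∈ D := by
  obtain ⟨d, hd⟩ := hD
  have h := N.star.map_formula
    (∀' ∀' (memF new (Sum.inl 0) ⟹ pairMemF (Sum.inl 1) (Sum.inl 2) new ⟹
      memF (Sum.inl 2) (up new) ⟹
      ∀' ∀' (memF (up new) (Sum.inl 0) ⟹ memF new (Sum.inl 0) ⟹
        memF (up new) (up (up (up new))) ⟹ pairMemF (Sum.inl 3) (up new) new ⟹
          pairMemF (Sum.inl 1) new (up (up new)) ⟹ memF new (up (up (up new)))) ⟹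
      memF new (up new)) : setLanguage.Formula (Fin 4))
    ![setCode.{u} (Set.univ : Set ℝ), relCode.{u} ((· ≤ ·) : ℝ → ℝ → Prop), code.{u} ℝ 0,
      relCode.{u} fun s t : ℝ => s ≤ t ∧ t - s ≤ δ]
  simp only [Formula.Realize, BoundedFormula.realize_all, BoundedFormula.realize_imp,
    realize_memF, realize_pairMemF, elim_up, elim_new, Sum.elim_inl, Function.comp_apply,
    Matrix.cons_val_zero, Matrix.cons_val_one, Matrix.cons_val, setMem_zfset, pairMem_zfset,
    mem_setCode] at h
  refine (hd T).2 (h.2 ?_ d T.1 T.2 hT ((hd _).1 h0) fun s t hs ht hsd hst htT =>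
    (hd ⟨t, ht⟩).1 (hstep ⟨s, hs⟩ ⟨t, ht⟩ ((hd _).2 hsd) hst htT))
  rintro d _ ⟨T, -, rfl⟩ hT h0 hstep
  rw [pair_mem_relCode] at hT
  have key : ∀ (n : ℕ) (t : ℝ), 0 ≤ t → t ≤ T → t ≤ n * δ → code.{u} ℝ t ∈ d := by
    intro n
    induction n with
    | zero =>
      intro t ht _ ht'
      obtain rfl : t = 0 := le_antisymm (by simpa using ht') ht
      exact h0
    | succ n ih =>
      intro t ht htT ht'
      push_cast at ht'
      -- the predecessor of `t` in a chain of steps of length at most `δ` starting at `0`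
      refine hstep (code.{u} ℝ (max 0 (t - δ))) _ ⟨_, trivial, rfl⟩ ⟨t, trivial, rfl⟩
        (ih _ (le_max_left _ _) (max_le hT (by linarith)) (max_le (by positivity) (by linarith)))
        ((pair_mem_relCode _ _ _).2 ⟨max_le ht (by linarith), ?_⟩)
        ((pair_mem_relCode _ _ _).2 htT)
      linarith [le_max_right 0 (t - δ)]
  obtain ⟨n, hn⟩ := exists_nat_ge (T / δ)
  exact key n T hT le_rfl ((div_le_iff₀ hδ).1 hn)

/-! ### Slices of an internal homotopy -/

variable {T : N.Ext.{u, v} ℝ} {h : N.Ext X → HyperInterval T → N.Ext Y}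

theorem internal_slice (hi : ∃ m : N.carrier, ∀ x t y, TripleMem m x.1 t.1.1 y.1 ↔ h x t = y)
    (t : HyperInterval T) : Internal fun x => h x t := by
  obtain ⟨m, hm⟩ := hi
  have h' := N.star.map_formula
    (∀' ∀' ∃' ∀' (memF new (Sum.inl 0) ⟹ ∀' (memF new (Sum.inl 1) ⟹
      (pairMemF (up (up new)) (up new) new ⇔
        tripleMemF (up (up (up (up new)))) (up new) (up (up (up new))) new))) :
        setLanguage.Formula (Fin 2))
    ![setCode (Set.univ : Set X), setCode (Set.univ : Set Y)]
  simp only [Formula.Realize, BoundedFormula.realize_all, BoundedFormula.realize_imp,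
    BoundedFormula.realize_iff, BoundedFormula.realize_ex, realize_memF, realize_pairMemF,
    realize_tripleMemF, elim_up, elim_new, Sum.elim_inl, Function.comp_apply, Matrix.cons_val_zero,
    Matrix.cons_val_one, setMem_zfset, pairMem_zfset, tripleMem_zfset] at h'
  obtain ⟨m', hm'⟩ := h'.2 (fun m t => by
    refine ⟨ZFSet.pairSep (fun x y => ZFSet.pair (ZFSet.pair x t) y ∈ m)
      (setCode (Set.univ : Set X)) (setCode (Set.univ : Set Y)), fun x hx y hy => ?_⟩
    rw [ZFSet.mem_pairSep]
    constructor
    · rintro ⟨x', -, y', -, he, h⟩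
      obtain ⟨rfl, rfl⟩ := ZFSet.pair_inj.1 he
      exact h
    · exact fun h => ⟨x, hx, y, hy, rfl, h⟩) m t.1.1
  exact ⟨m', fun x y => (hm' x.1 x.2 y.1 y.2).trans (hm x t y)⟩

/-- The set of times at which an internal homotopy is close to a given standard map. -/
theorem isInternalSet_close (hi : ∃ m : N.carrier, ∀ x t y, TripleMem m x.1 t.1.1 y.1 ↔ h x t = y)
    (k : X → Y) (W : Set (Y × Y)) :
    IsInternalSet (N := N) (X := ℝ) {t | ∃ ht : extRel (· ≤ ·) (N.pt 0) t ∧ extRel (· ≤ ·) t T,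
      ∀ x, extRel (fun a b => (a, b) ∈ W) (extMap N k x) (h x ⟨t, ht⟩)} := by
  obtain ⟨m, hm⟩ := hi
  have h' := N.star.map_formula
    (∀' ∀' ∃' ∀' (memF new (Sum.inl 0) ⟹ (memF new (up new) ⇔
      ((pairMemF (Sum.inl 1) (Sum.inl 2) new ⊓ pairMemF (Sum.inl 1) new (up (up new))) ⊓
        ∀' (memF new (Sum.inl 3) ⟹ ∀' (memF new (Sum.inl 4) ⟹
          tripleMemF (up (up (up (up (up new))))) (up new) (up (up new)) new ⟹
          ∀' (memF new (Sum.inl 4) ⟹ pairMemF (Sum.inl 5) (up (up new)) new ⟹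
            pairMemF (Sum.inl 6) new (up new))))))) : setLanguage.Formula (Fin 7))
    ![setCode.{u} (Set.univ : Set ℝ), relCode.{u} ((· ≤ ·) : ℝ → ℝ → Prop), code.{u} ℝ 0,
      setCode (Set.univ : Set X), setCode (Set.univ : Set Y), relCode fun a b => k a = b,
      relCode fun a b => (a, b) ∈ W]
  simp only [Formula.Realize, BoundedFormula.realize_all, BoundedFormula.realize_imp,
    BoundedFormula.realize_iff, BoundedFormula.realize_ex, BoundedFormula.realize_inf,
    realize_memF, realize_pairMemF, realize_tripleMemF, elim_up, elim_new, Sum.elim_inl,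
    Function.comp_apply, Matrix.cons_val_zero, Matrix.cons_val_one, Matrix.cons_val,
    setMem_zfset, pairMem_zfset, tripleMem_zfset] at h'
  obtain ⟨d, hd⟩ := h'.2 (fun m T => by
    refine ⟨ZFSet.sep (fun t =>
      (ZFSet.pair (code.{u} ℝ 0) t ∈ relCode.{u} ((· ≤ ·) : ℝ → ℝ → Prop) ∧
      ZFSet.pair t T ∈ relCode.{u} ((· ≤ ·) : ℝ → ℝ → Prop)) ∧
      ∀ x ∈ setCode (Set.univ : Set X), ∀ y ∈ setCode (Set.univ : Set Y),
        ZFSet.pair (ZFSet.pair x t) y ∈ m → ∀ y' ∈ setCode (Set.univ : Set Y),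
          ZFSet.pair x y' ∈ relCode (fun a b => k a = b) →
            ZFSet.pair y' y ∈ relCode (fun a b => (a, b) ∈ W))
      (setCode.{u} (Set.univ : Set ℝ)), fun t ht => ?_⟩
    rw [ZFSet.mem_sep]
    exact and_iff_right ht) m T.1
  refine ⟨d, fun t => Iff.trans ?_ (hd t.1 t.2).symm⟩
  constructor
  · rintro ⟨ht, hx⟩
    refine ⟨ht, fun x hxX y hy hxy y' hy' hk => ?_⟩
    have h₁ := (hm ⟨x, hxX⟩ ⟨t, ht⟩ ⟨y, hy⟩).1 hxy
    have h₂ := (extRel_graph_iff k ⟨x, hxX⟩ ⟨y', hy'⟩).1 hk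
    have h₃ := hx ⟨x, hxX⟩
    rw [h₁, h₂] at h₃
    exact h₃
  · rintro ⟨ht, hx⟩
    exact ⟨ht, fun x => hx x.1 x.2 (h x ⟨t, ht⟩).1 (h x ⟨t, ht⟩).2 ((hm x ⟨t, ht⟩ _).2 rfl)
      (extMap N k x).1 (extMap N k x).2 ((extRel_graph_iff k x _).2 rfl)⟩

end NonstandardUniverse

/-! ### Homotopy invariance -/

section HomotopyInvariance

variable {N : NonstandardUniverse.{u, v}} {P Q : UPairS N}

/-- The S-continuous map `h(·, t)`. -/
def IsSHomotopy.slice {f g : P ⟶ Q} {T : N.Ext ℝ}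
    {h : N.Ext P.as.carrier → HyperInterval T → N.Ext Q.as.carrier} (H : IsSHomotopy f g T h)
    (t : HyperInterval T) : P ⟶ Q where
  toFun x := h x t
  internal := internal_slice H.internal t
  sContinuous _ _ hx := H.sContinuous _ _ t t hx (near_refl _)
  mapsTo x hx := H.mapsTo x hx t

/-- Nearby slices of a homotopy share a preshadow taken from a fixed finite set, so the times at
which the slice induces the same homomorphism as the initial one are, for a given cover, covered by
an internal set which is closed under small standard increments. By the transferred Archimedean
property this set reaches the final time, however large. -/
theorem inducedMap_eq_of_sBulletHomotopic (hP : IsPrecompactPair P.as)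
    (hQ : IsPrecompactPair Q.as) (G : Type u) [AddCommGroup G] (n : ℕ) {f g : P ⟶ Q}
    (hfg : SBulletHomotopic f g) : inducedMap hP hQ G n f = inducedMap hP hQ G n g := by
  obtain ⟨T, hT, h, H⟩ := hfg
  refine limit.hom_ext fun 𝒱 => ?_
  let Φ : (P ⟶ Q) → (uvHomology G n P.as ⟶ _) := fun f =>
    inducedMap hP hQ G n f ≫ uvProj G n Q.as 𝒱.unop
  let t₀ : HyperInterval T := ⟨N.pt 0, extRel_refl le_refl _, hT⟩
  let t₁ : HyperInterval T := ⟨T, hT, extRel_refl le_refl _⟩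
  have h₀ : H.slice t₀ = f := UPairS.Hom.ext (funext fun x => H.map_zero x t₀ rfl)
  have h₁ : H.slice t₁ = g := UPairS.Hom.ext (funext fun x => H.map_end x t₁ rfl)
  suffices hΦ : Φ (H.slice t₁) = Φ (H.slice t₀) by
    rw [h₀, h₁] at hΦ
    exact hΦ.symm
  obtain ⟨V, hV, hV𝒱⟩ := 𝒱.unop.2
  obtain ⟨W, hW, -, hWV⟩ := exists_symm_half hV
  obtain ⟨W₁, hW₁, -, hW₁W⟩ := exists_symm_half hW
  have hW₁W' : ∀ a b, (a, b) ∈ W₁ → (a, b) ∈ W := fun a b h =>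
    hW₁W _ _ _ h (refl_mem_uniformity hW₁)
  obtain ⟨W₂, hW₂, hpre⟩ := exists_finite_preshadows hP hQ hW₁
  obtain ⟨U, hU, E, hE, hh⟩ := exists_entourage_of_homotopy H.internal H.sContinuous
    (Filter.inter_mem hW₁ hW₂)
  obtain ⟨K, hK, hKf⟩ := hpre U hU
  obtain ⟨ε, hε, hεE⟩ := Metric.mem_uniformity_dist.1 hE
  -- The set of times `t` with `Φ (h(·, t)) = Φ f` is not visibly internal. The induction runs on
  -- `⋃ k ∈ K', D k` instead, which is internal because `K'` is a finite set of standard maps.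
  let K' : Set (P.as.carrier → Q.as.carrier) :=
    K ∩ {k | ∃ s, IsPreshadow (H.slice s) W k ∧ Φ (H.slice s) = Φ (H.slice t₀)}
  let D : (P.as.carrier → Q.as.carrier) → Set (N.Ext ℝ) := fun k =>
    {t | ∃ ht : extRel (· ≤ ·) (N.pt 0) t ∧ extRel (· ≤ ·) t T,
      ∀ x, extRel (fun a b => (a, b) ∈ W) (extMap N k x) (h x ⟨t, ht⟩)}
  have hslice : ∀ t, ∃ k ∈ K, IsPreshadow (H.slice t) W₁ k := fun t =>
    hKf (H.slice t) fun x x' hx => (hh x x' t t hx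
      (extRel_refl (fun _ => refl_mem_uniformity hE) _)).mono fun _ _ h => h.2
  have hmono : ∀ {t k}, IsPreshadow (H.slice t) W₁ k → IsPreshadow (H.slice t) W k := fun hk =>
    { mapsTo := hk.mapsTo
      uniformlyContinuous := hk.uniformlyContinuous.imp fun _ hU₀ =>
        ⟨hU₀.1, fun x y hxy => hW₁W' _ _ (hU₀.2 x y hxy)⟩
      close := fun x => (hk.close x).mono hW₁W' }
  have hΦ : ∀ t (ht : t ∈ ⋃ k ∈ K', D k), ∃ ht', Φ (H.slice ⟨t, ht'⟩) = Φ (H.slice t₀) := by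
    intro t ht
    obtain ⟨k, ⟨hk, s, hs, hsΦ⟩, ht', hkt⟩ := Set.mem_iUnion₂.1 ht
    exact ⟨ht', (inducedMap_proj_eq_of_isPreshadow hP hQ G n hV𝒱 hW hWV
      (f := H.slice ⟨t, ht'⟩) (g := H.slice s)
      ⟨hs.mapsTo, hs.uniformlyContinuous, hkt⟩ hs).trans hsΦ⟩
  have hint : IsInternalSet (⋃ k ∈ K', D k) := isInternalSet_biUnion (hK.subset fun k hk => hk.1)
    fun k => isInternalSet_close H.internal k W
  have hfin : T ∈ ⋃ k ∈ K', D k := by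
    refine hint.archimedean_induction (half_pos hε) hT ?_ ?_
    · obtain ⟨k, hk, hkp⟩ := hslice t₀
      exact Set.mem_iUnion₂.2 ⟨k, ⟨hk, t₀, hmono hkp, rfl⟩, t₀.2, (hmono hkp).close⟩
    · intro s t hs hst htT
      obtain ⟨hs', hsΦ⟩ := hΦ s hs
      obtain ⟨k, hk, hkp⟩ := hslice ⟨s, hs'⟩
      have ht0 : extRel (· ≤ ·) (N.pt 0) t := hs'.1.trans (fun a b c hab hbc => hab.trans hbc.1) hst
      refine Set.mem_iUnion₂.2 ⟨k, ⟨hk, ⟨s, hs'⟩, hmono hkp, hsΦ⟩, ⟨ht0, htT⟩, fun x => ?_⟩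
      refine (hkp.close x).trans (fun a b c h₁ h₂ => hW₁W a b c h₁ h₂.1)
        (hh x x ⟨s, hs'⟩ ⟨t, ht0, htT⟩ (extRel_refl (fun _ => refl_mem_uniformity hU) _)
          (hst.mono fun a b hab => hεE ?_))
      rw [dist_comm, Real.dist_eq, abs_of_nonneg (sub_nonneg.2 hab.1)]
      linarith [hab.2]
  exact (hΦ T hfin).2

end HomotopyInvariance

/-- Uniform Vietoris homology extends, along the embedding `f ↦ *f`, from precompact uniform pairs
and uniformly continuous maps to a functor `F` on `pUPair_S`, whose value at an S-continuous map is
the unique homomorphism induced through preshadows; and `S_•`-homotopic S-continuous maps induce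
the same homomorphism. -/
theorem mainTheorem2 (N : NonstandardUniverse.{u, v}) (G : Type u) [AddCommGroup G] (n : ℕ) :
    ∃ (F : PUPairS N ⥤ AddCommGrpCat.{u})
      (e : pStarFunctor N ⋙ F ≅ IsPrecompactPair.{u}.ι ⋙ uniformVietorisHomology G n),
      (∀ (P Q : PUPair.{u}) (f : (pStarFunctor N).obj P ⟶ (pStarFunctor N).obj Q)
        (φ : uvHomology G n P.obj ⟶ uvHomology G n Q.obj),
        IsInducedBy G n f.hom φ ↔ φ = e.inv.app P ≫ F.map f ≫ e.hom.app Q) ∧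
      ∀ (P Q : PUPairS N) (f g : P ⟶ Q),
        SBulletHomotopic f.hom g.hom → F.map f = F.map g := by
  refine ⟨sHomology G n N, pStarFunctorCompSHomologyIso G n N, fun P Q f φ => ?_,
    fun P Q f g h => inducedMap_eq_of_sBulletHomotopic P.property Q.property G n h⟩
  have hf : (pStarFunctorCompSHomologyIso G n N).inv.app P ≫ (sHomology G n N).map f ≫
      (pStarFunctorCompSHomologyIso G n N).hom.app Q =
      inducedMap (P := (starFunctor N).obj P.obj) (Q := (starFunctor N).obj Q.obj) P.property
        Q.property G n f.hom :=
    (Category.id_comp _).trans (Category.comp_id _)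
  rw [hf]
  exact isInducedBy_iff_eq_inducedMap (P := (starFunctor N).obj P.obj)
    (Q := (starFunctor N).obj Q.obj) P.property Q.property G n f.hom φ
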